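/- Let $C:\mathbb C^{\mathbb N}\to\mathbb C^{\mathbb N}$, $C(x)=\big(\tfrac1n\sum_{k=1}^n x_k\big)_{n\ge1}$, be the Cesàro operator, and write $|x|=(|x_n|)_n$. A linear subspace $X\subseteq\mathbb C^{\mathbb N}$ is *solid* if $x\in X$, $y\in\mathbb C^{\mathbb N}$ and $|y|\le|x|$ coordinatewise imply $y\in X$. For $1<q<\infty$ let $\mathrm{ces}(q)=\{x\in\mathbb C^{\mathbb N}: C(|x|)\in\ell_q\}$ with the norm $\|x\|_{\mathrm{ces}(q)}=\|C(|x|)\|_q$. For $1<p\le\infty$ let $$\ell_{p-}=\bigcup_{1<q<p}\ell_q,\qquad \mathrm{ces}(p-)=\bigcup_{1<q<p}\mathrm{ces}(q),$$ each with the locally convex inductive limit topology, and for $1\le r<\infty$ let $\ell_{r+}=\bigcap_{r<q<\infty}\ell_q$ with the Fréchet topology given by the norms $\|\cdot\|_q$, $q>r$. Let $p'\in[1,\infty)$ be defined by $\frac1p+\frac1{p'}=1$ (so $p'=1$ if $p=\infty$), let $X'_\beta$ denote the strong dual of $X$, and let $\simeq$ denote linear topological isomorphism. An (LB)-space, i.e.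 an inductive limit of an increasing sequence of Banach spaces, is *regular* if every bounded set is contained and bounded in some step. Let $[C,\ell_{p-}]_s$ be the largest solid linear subspace $X\subseteq\mathbb C^{\mathbb N}$ with $C(X)\subseteq\ell_{p-}$. (i) For each $1<p\le\infty$ the space $\ell_{p-}$ is a regular (LB)-space; more precisely, for every strictly increasing sequence $(p_k)_k\subseteq(1,p)$ with $p_k\uparrow p$ it is the regular inductive limit of the Banach spaces $\ell_{p_k}$. It is reflexive but not Montel. It is a (DF)-space, and $\ell_{p-}\simeq(\ell_{p'+})'_\beta$ and $(\ell_{p-})'_\beta\simeq\ell_{p'+}$. (ii) For $1<p\le q\le\infty$ the natural inclusion $\ell_{p-}\subseteq\ell_{q-}$ holds and is continuous, and $\ell_{p-}\subsetneq\ell_{q-}$ if $p<q$. Also, for $1<p\le q\le\infty$, the inclusion $\ell_{p-}\subseteq\mathrm{ces}(q-)$ holds, is continuous, and is proper. (iii) For $1<p\le q\le\infty$ both Cesàro operators $C:\ell_{p-}\to\ell_{q-}$ and $C:\mathrm{ces}(p-)\to\ell_{q-}$ are (well defined and) continuous. (iv) For $1<p\le\infty$ and $x\in\mathbb C^{\mathbb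 N}$, $C^2(|x|)\in\ell_{p-}$ if and only if $C(|x|)\in\ell_{p-}$. (v) For every $1<p\le\infty$, $[C,\ell_{p-}]_s=\mathrm{ces}(p-)$. -/

import Mathlib

open scoped ENNReal Topology

noncomputable section

/-! ### The Cesàro operator

Sequences `(x₁, x₂, …)` are indexed by `ℕ` starting from `0`: the entry `x_{n+1}` is `x n`. -/

/-- The Cesàro operator `C(x) = (x₁, (x₁ + x₂)/2, (x₁ + x₂ + x₃)/3, …)`. -/
def cesaro : (ℕ → ℂ) →ₗ[ℂ] (ℕ → ℂ) where
  toFun x n := (∑ k ∈ Finset.range (n + 1), x k) / ((n : ℂ) + 1)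
  map_add' x y := by
    funext n
    simp [Finset.sum_add_distrib, add_div]
  map_smul' c x := by
    funext n
    simp [← Finset.mul_sum, mul_div_assoc]

/-- The sequence `|x| = (|x₁|, |x₂|, …)`. -/
def absSeq (x : ℕ → ℂ) : ℕ → ℂ := fun n => ((‖x n‖ : ℝ) : ℂ)

/-- A linear subspace `X` of `ℂ^ℕ` is solid if `|y| ≤ |x|` and `x ∈ X` imply `y ∈ X`. -/
def IsSolid (X : Submodule ℂ (ℕ → ℂ)) : Prop :=
  ∀ x ∈ X, ∀ y : ℕ → ℂ, (∀ n, ‖y n‖ ≤ ‖x n‖) → y ∈ X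

theorem norm_cesaro_absSeq (x : ℕ → ℂ) (n : ℕ) :
    ‖cesaro (absSeq x) n‖ = (∑ k ∈ Finset.range (n + 1), ‖x k‖) / ((n : ℝ) + 1) := by
  have h : cesaro (absSeq x) n
      = (((∑ k ∈ Finset.range (n + 1), ‖x k‖) / ((n : ℝ) + 1) : ℝ) : ℂ) := by
    simp [cesaro, absSeq]
  rw [h, Complex.norm_real, Real.norm_of_nonneg (by positivity)]

theorem norm_cesaro_absSeq_add_le (x y : ℕ → ℂ) (n : ℕ) :
    ‖cesaro (absSeq (x + y)) n‖ ≤ ‖(cesaro (absSeq x) + cesaro (absSeq y)) n‖ := by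
  have h : cesaro (absSeq x) + cesaro (absSeq y)
      = cesaro (absSeq (fun k => (((‖x k‖ + ‖y k‖ : ℝ)) : ℂ))) := by
    rw [← map_add]
    congr 1
    funext k
    simp only [absSeq, Pi.add_apply, Complex.norm_real]
    rw [Real.norm_of_nonneg (by positivity)]
    push_cast
    rfl
  rw [h, norm_cesaro_absSeq, norm_cesaro_absSeq]
  gcongr with k hk
  rw [Complex.norm_real, Real.norm_of_nonneg (by positivity)]
  exact norm_add_le _ _

theorem cesaro_absSeq_smul (c : ℂ) (x : ℕ → ℂ) :
    cesaro (absSeq (c • x)) = ((‖c‖ : ℝ) : ℂ) • cesaro (absSeq x) := by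
  rw [← map_smul]
  congr 1
  funext k
  simp [absSeq]

theorem cesaro_absSeq_zero : cesaro (absSeq 0) = 0 := by
  have : absSeq 0 = 0 := by
    funext k
    simp [absSeq]
  rw [this, map_zero]

theorem memℓp_of_norm_le {q : ℝ≥0∞} {x y : ℕ → ℂ} (hx : Memℓp x q)
    (h : ∀ n, ‖y n‖ ≤ ‖x n‖) : Memℓp y q :=
  Memℓp.mono (memℓp_norm_iff.2 hx) h

/-! ### The Banach spaces `ℓ_q` and `ces(q)` -/

/-- The Banach space `ℓ_q` of complex sequences, with its usual norm. -/
abbrev Ell (q : ℝ≥0∞) : Type := lp (fun _ : ℕ => ℂ) q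

/-- The linear subspace `ces(q) = {x : C(|x|) ∈ ℓ_q}` of `ℂ^ℕ`. -/
def ces (q : ℝ≥0∞) : Submodule ℂ (ℕ → ℂ) where
  carrier := {x | Memℓp (cesaro (absSeq x)) q}
  add_mem' {x y} hx hy := memℓp_of_norm_le (hx.add hy) (norm_cesaro_absSeq_add_le x y)
  zero_mem' := by
    change Memℓp (cesaro (absSeq 0)) q
    rw [cesaro_absSeq_zero]
    exact zero_memℓp
  smul_mem' c x hx := by
    change Memℓp (cesaro (absSeq (c • x))) q
    rw [cesaro_absSeq_smul]
    exact Memℓp.const_smul hx _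

/-- `ces(q)` as a type of its own, which carries the norm `‖x‖ = ‖C(|x|)‖_q` (and not the topology
of coordinatewise convergence). -/
def Ces (q : ℝ≥0∞) : Type := ces q

namespace Ces

variable {q : ℝ≥0∞}

instance : AddCommGroup (Ces q) := inferInstanceAs (AddCommGroup (ces q))

instance : Module ℂ (Ces q) := inferInstanceAs (Module ℂ (ces q))

/-- The sequence underlying an element of `ces(q)`. -/
def toSeq : Ces q →ₗ[ℂ] (ℕ → ℂ) := (ces q).subtype

/-- The element `C(|x|)` of `ℓ_q`, for `x ∈ ces(q)`. -/
def cesaroAbs (x : Ces q) : Ell q := ⟨cesaro (absSeq (toSeq x)), x.2⟩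

instance : Norm (Ces q) := ⟨fun x => ‖cesaroAbs x‖⟩

theorem norm_def (x : Ces q) : ‖x‖ = ‖cesaroAbs x‖ := rfl

theorem toSeq_injective : Function.Injective (toSeq : Ces q → ℕ → ℂ) := Subtype.coe_injective

theorem coe_cesaroAbs (x : Ces q) : (cesaroAbs x : ℕ → ℂ) = cesaro (absSeq (toSeq x)) := rfl

theorem norm_smul_eq [Fact (1 ≤ q)] (c : ℂ) (x : Ces q) : ‖c • x‖ = ‖c‖ * ‖x‖ := by
  have h : cesaroAbs (c • x) = ((‖c‖ : ℝ) : ℂ) • cesaroAbs x := by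
    apply lp.ext
    rw [lp.coeFn_smul, coe_cesaroAbs, coe_cesaroAbs, map_smul, cesaro_absSeq_smul]
  rw [norm_def, norm_def, h, norm_smul, Complex.norm_real, norm_norm]

theorem norm_add_le_add [Fact (1 ≤ q)] (x y : Ces q) : ‖x + y‖ ≤ ‖x‖ + ‖y‖ := by
  have hq : q ≠ 0 := (zero_lt_one.trans_le (Fact.out : 1 ≤ q)).ne'
  rw [norm_def, norm_def, norm_def]
  refine le_trans ?_ (norm_add_le (cesaroAbs x) (cesaroAbs y))
  refine lp.norm_mono hq fun n => ?_
  rw [lp.coeFn_add, coe_cesaroAbs, coe_cesaroAbs, coe_cesaroAbs, map_add]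
  exact norm_cesaro_absSeq_add_le (toSeq x) (toSeq y) n

theorem norm_eq_zero_iff_eq [Fact (1 ≤ q)] (x : Ces q) : ‖x‖ = 0 ↔ x = 0 := by
  rw [norm_def, norm_eq_zero]
  constructor
  · intro h
    have h1 : cesaro (absSeq (toSeq x)) = 0 := by
      rw [← coe_cesaroAbs, h, lp.coeFn_zero]
    apply toSeq_injective
    rw [map_zero]
    funext n
    have h2 : ‖cesaro (absSeq (toSeq x)) n‖ = 0 := by
      rw [h1, Pi.zero_apply, norm_zero]
    rw [norm_cesaro_absSeq, div_eq_zero_iff] at h2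
    rcases h2 with h2 | h2
    · have h3 := (Finset.sum_eq_zero_iff_of_nonneg (fun _ _ => norm_nonneg _)).1 h2 n
        (Finset.self_mem_range_succ n)
      exact norm_eq_zero.1 h3
    · exact absurd h2 (by positivity)
  · rintro rfl
    apply lp.ext
    rw [lp.coeFn_zero, coe_cesaroAbs, map_zero, cesaro_absSeq_zero]

theorem normedSpaceCore [Fact (1 ≤ q)] : NormedSpace.Core ℂ (Ces q) where
  norm_nonneg x := norm_nonneg (cesaroAbs x)
  norm_smul := norm_smul_eq
  norm_triangle := norm_add_le_add
  norm_eq_zero_iff := norm_eq_zero_iff_eq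

instance [Fact (1 ≤ q)] : NormedAddCommGroup (Ces q) := NormedAddCommGroup.ofCore normedSpaceCore

instance [Fact (1 ≤ q)] : NormedSpace ℂ (Ces q) := NormedSpace.ofCore normedSpaceCore

end Ces

/-! ### Inductive limits of locally convex spaces and classes of locally convex spaces -/

/-- The locally convex inductive limit topology on `V` with respect to linear maps `j i : E i → V`:
the finest locally convex vector space topology on `V` for which all `j i` are continuous.
(In Mathlib's order on topologies, `sInf` is the coarsest topology finer than all the given ones;
it is itself locally convex and makes all `j i` continuous.) -/
@[reducible]
def indLimTopology {ι : Type*} {E : ι → Type*} [∀ i, AddCommGroup (E i)] [∀ i, Module ℂ (E i)]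
    [∀ i, TopologicalSpace (E i)] {V : Type*} [AddCommGroup V] [Module ℂ V]
    (j : ∀ i, E i →ₗ[ℂ] V) : TopologicalSpace V :=
  sInf {t : TopologicalSpace V |
    @IsTopologicalAddGroup V t _ ∧
    @ContinuousSMul ℂ V _ _ t ∧
    @LocallyConvexSpace ℝ V _ _ _ _ t ∧
    ∀ i, @Continuous (E i) V _ t (j i)}

section Classes

variable (V : Type*) [AddCommGroup V] [Module ℂ V] [TopologicalSpace V]

/-- `V` is the (Hausdorff) inductive limit of the increasing sequence of Banach spaces `E n`,
embedded in `V` by the maps `j n`, and this limit is regular: every bounded subset of `V` is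
contained and bounded in some step. -/
structure IsRegularLBLimit (E : ℕ → Type*) [∀ n, NormedAddCommGroup (E n)]
    [∀ n, NormedSpace ℂ (E n)] [∀ n, CompleteSpace (E n)] (j : ∀ n, E n →ₗ[ℂ] V) : Prop where
  t2 : T2Space V
  injective : ∀ n, Function.Injective (j n)
  step : ∀ n, ∃ i : E n →L[ℂ] E (n + 1), ∀ x, j (n + 1) (i x) = j n x
  exhaust : ∀ v : V, ∃ n, ∃ x : E n, j n x = v
  topology_eq : ‹TopologicalSpace V› = indLimTopology j
  regular : ∀ B : Set V, Bornology.IsVonNBounded ℂ B →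
    ∃ n, ∃ A : Set (E n), Bornology.IsBounded A ∧ B ⊆ j n '' A

/-- A regular (LB)-space. -/
def IsRegularLBSpace : Prop :=
  ∃ (E : ℕ → Type) (_ : ∀ n, NormedAddCommGroup (E n)) (_ : ∀ n, NormedSpace ℂ (E n))
    (_ : ∀ n, CompleteSpace (E n)) (j : ∀ n, E n →ₗ[ℂ] V), IsRegularLBLimit V E j

/-- Reflexivity: the canonical map `V → (V'_β)'_β` is a well-defined topological isomorphism.
(`StrongDual` carries the topology of uniform convergence on bounded sets.) -/
def IsReflexiveSpace : Prop :=
  ∃ e : V ≃L[ℂ] StrongDual ℂ (StrongDual ℂ V), ∀ (x : V) (f : StrongDual ℂ V), e x f = f x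

/-- A Montel space: a barrelled locally convex Hausdorff space in which closed bounded sets are
compact. (Mathlib's `MontelSpace` is the last property alone.) -/
def IsMontelLCS : Prop :=
  IsTopologicalAddGroup V ∧ ContinuousSMul ℂ V ∧ LocallyConvexSpace ℝ V ∧ T2Space V ∧
    BarrelledSpace ℂ V ∧ MontelSpace ℂ V

/-- A (DF)-space: a locally convex Hausdorff space with a fundamental sequence of bounded sets, in
which every intersection of a sequence of absolutely convex neighbourhoods of `0` which absorbs
all bounded sets is itself a neighbourhood of `0`. -/
structure IsDFSpace : Prop where
  isTopologicalAddGroup : IsTopologicalAddGroup V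
  continuousSMul : ContinuousSMul ℂ V
  locallyConvex : LocallyConvexSpace ℝ V
  t2 : T2Space V
  fundamental : ∃ B : ℕ → Set V, (∀ n, Bornology.IsVonNBounded ℂ (B n)) ∧
    ∀ S : Set V, Bornology.IsVonNBounded ℂ S → ∃ n, S ⊆ B n
  inter_mem_nhds : ∀ U : ℕ → Set V,
    (∀ n, U n ∈ 𝓝 (0 : V) ∧ Balanced ℂ (U n) ∧ Convex ℝ (U n)) →
    (∀ S : Set V, Bornology.IsVonNBounded ℂ S → Absorbs ℂ (⋂ n, U n) S) →
    (⋂ n, U n) ∈ 𝓝 (0 : V)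

end Classes

/-! ### The (LB)-spaces `ℓ_{p-}` and `ces(p-)`, for `1 < p ≤ ∞` -/

/-- The exponents `q` with `1 < q < p`. -/
abbrev ExpBelow (p : ℝ≥0∞) : Type := {q : ℝ≥0∞ // 1 < q ∧ q < p}

instance {p : ℝ≥0∞} (q : ExpBelow p) : Fact (1 ≤ q.1) := ⟨q.2.1.le⟩

/-- The linear space `ℓ_{p-} = ⋃_{1 < q < p} ℓ_q`. -/
def ellMinus (p : ℝ≥0∞) [Fact (1 < p)] : Submodule ℂ (ℕ → ℂ) where
  carrier := {x | ∃ q : ExpBelow p, Memℓp x q.1}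
  add_mem' := by
    rintro x y ⟨q, hq⟩ ⟨r, hr⟩
    rcases le_total q.1 r.1 with h | h
    · exact ⟨r, (hq.of_exponent_ge h).add hr⟩
    · exact ⟨q, hq.add (hr.of_exponent_ge h)⟩
  zero_mem' := by
    obtain ⟨q, hq⟩ := exists_between (Fact.out : 1 < p)
    exact ⟨⟨q, hq⟩, zero_memℓp⟩
  smul_mem' := by
    rintro c x ⟨q, hq⟩
    exact ⟨q, hq.const_smul c⟩

/-- The linear space `ces(p-) = ⋃_{1 < q < p} ces(q)`. -/
def cesMinus (p : ℝ≥0∞) [Fact (1 < p)] : Submodule ℂ (ℕ → ℂ) where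
  carrier := {x | ∃ q : ExpBelow p, x ∈ ces q.1}
  add_mem' := by
    rintro x y ⟨q, hq⟩ ⟨r, hr⟩
    rcases le_total q.1 r.1 with h | h
    · exact ⟨r, (ces r.1).add_mem (Memℓp.of_exponent_ge hq h) hr⟩
    · exact ⟨q, (ces q.1).add_mem hq (Memℓp.of_exponent_ge hr h)⟩
  zero_mem' := by
    obtain ⟨q, hq⟩ := exists_between (Fact.out : 1 < p)
    exact ⟨⟨q, hq⟩, (ces q).zero_mem⟩
  smul_mem' := by
    rintro c x ⟨q, hq⟩
    exact ⟨q, (ces q.1).smul_mem c hq⟩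

/-- `ℓ_{p-}` as a type of its own, which carries the inductive limit topology. -/
def EllMinus (p : ℝ≥0∞) [Fact (1 < p)] : Type := ellMinus p

/-- `ces(p-)` as a type of its own, which carries the inductive limit topology. -/
def CesMinus (p : ℝ≥0∞) [Fact (1 < p)] : Type := cesMinus p

section Minus

variable {p : ℝ≥0∞} [Fact (1 < p)]

instance : AddCommGroup (EllMinus p) := inferInstanceAs (AddCommGroup (ellMinus p))

instance : Module ℂ (EllMinus p) := inferInstanceAs (Module ℂ (ellMinus p))

instance : AddCommGroup (CesMinus p) := inferInstanceAs (AddCommGroup (cesMinus p))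

instance : Module ℂ (CesMinus p) := inferInstanceAs (Module ℂ (cesMinus p))

/-- The sequence underlying an element of `ℓ_{p-}`. -/
def EllMinus.toSeq : EllMinus p →ₗ[ℂ] (ℕ → ℂ) := (ellMinus p).subtype

/-- The sequence underlying an element of `ces(p-)`. -/
def CesMinus.toSeq : CesMinus p →ₗ[ℂ] (ℕ → ℂ) := (cesMinus p).subtype

/-- The inclusion `ℓ_q ⊆ ℓ_{p-}`, for `1 < q < p`. -/
def EllMinus.incl (q : ExpBelow p) : Ell q.1 →ₗ[ℂ] EllMinus p where
  toFun x := ⟨x, q, lp.memℓp x⟩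
  map_add' _ _ := rfl
  map_smul' _ _ := rfl

/-- The inclusion `ces(q) ⊆ ces(p-)`, for `1 < q < p`. -/
def CesMinus.incl (q : ExpBelow p) : Ces q.1 →ₗ[ℂ] CesMinus p where
  toFun x := ⟨Ces.toSeq x, q, x.2⟩
  map_add' _ _ := rfl
  map_smul' _ _ := rfl

instance : TopologicalSpace (EllMinus p) := indLimTopology EllMinus.incl

instance : TopologicalSpace (CesMinus p) := indLimTopology CesMinus.incl

end Minus

/-! ### The Fréchet spaces `ℓ_{r+}`, for `1 ≤ r < ∞` -/

/-- The exponents `q` with `r < q < ∞`. -/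
abbrev ExpAbove (r : ℝ≥0∞) : Type := {q : ℝ≥0∞ // r < q ∧ q < ∞}

instance {r : ℝ≥0∞} [Fact (1 ≤ r)] (q : ExpAbove r) : Fact (1 ≤ q.1) :=
  ⟨(Fact.out : 1 ≤ r).trans q.2.1.le⟩

/-- The linear space `ℓ_{r+} = ⋂_{q > r} ℓ_q`. -/
def ellPlus (r : ℝ≥0∞) : Submodule ℂ (ℕ → ℂ) where
  carrier := {x | ∀ q : ExpAbove r, Memℓp x q.1}
  add_mem' hx hy q := (hx q).add (hy q)
  zero_mem' _ := zero_memℓp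
  smul_mem' c _ hx q := (hx q).const_smul c

/-- `ℓ_{r+}` as a type of its own, which carries the topology given by the norms `‖·‖_q`,
`q > r`. -/
def EllPlus (r : ℝ≥0∞) : Type := ellPlus r

section Plus

variable {r : ℝ≥0∞}

instance : AddCommGroup (EllPlus r) := inferInstanceAs (AddCommGroup (ellPlus r))

instance : Module ℂ (EllPlus r) := inferInstanceAs (Module ℂ (ellPlus r))

/-- The inclusion `ℓ_{r+} ⊆ ℓ_q`, for `r < q < ∞`. -/
def EllPlus.toEll (q : ExpAbove r) : EllPlus r →ₗ[ℂ] Ell q.1 where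
  toFun x := ⟨x.1, x.2 q⟩
  map_add' _ _ := rfl
  map_smul' _ _ := rfl

instance [Fact (1 ≤ r)] : TopologicalSpace (EllPlus r) :=
  ⨅ q : ExpAbove r, TopologicalSpace.induced (EllPlus.toEll q) inferInstance

end Plus

end

/-! Part (i) rests on the pairing `∑ x_i y_i` of `ℓ_{p-}` and `ℓ_{p'+}`. Conjugation of exponents
exchanges those below `p` with those above `p'`, so Hölder's inequality makes each space act
continuously on the other. The quantitative converse of Hölder (`exists_ell_of_dual_bound`) shows
that every continuous functional arises in this way. The key point is regularity
(`EllMinus.exists_subset_image_closedBall`). A bounded set of `ℓ_{p-}` is a pointwise bounded family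
of functionals on `ℓ_{p'+}`, which is Fréchet and hence barrelled. The family is therefore dominated
by a multiple of one norm `‖·‖_s`, and the converse of Hölder puts the set in a ball of the
conjugate step. Regularity identifies `ℓ_{p'+}` topologically with the strong dual of `ℓ_{p-}`; the
bipolar theorem identifies `ℓ_{p-}` with the strong dual of `ℓ_{p'+}`, and reflexivity is the
composition of the two. The (DF) property holds because absolutely convex sets absorbing all bounded
sets are neighbourhoods of `0`. The unit vectors form a bounded set without compact closure, so the
space is not Montel. For (ii) and (iii), Hardy's inequality gives `ℓ_q ⊆ ces(q)` continuously, and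
the universal property of inductive limits passes continuity from the steps to the limit. Properness
is witnessed by `n^{-1/p}` and by the indicator of the powers of two. Part (iv) combines Hardy's
inequality with the bound `C(|x|)_n ≤ 4 C²(|x|)_{2n}` (0-based indices), and (v) is solidity applied
to `|x|`. -/

noncomputable section

/-! ### Inequalities in sequence spaces -/

/-- Since `S = S^{1/q} S^{1/s}`, a positive `S` allows cancelling `S^{1/q}`. This absorption ends
both the converse of Hölder and Hardy's inequality, where `S` is a finite sum. -/
theorem le_rpow_of_le_mul_rpow {q s : ℝ} (h : q.HolderConjugate s) {S M : ℝ} (hS : 0 ≤ S)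
    (hM : 0 ≤ M) (hle : S ≤ M * S ^ (1 / q)) : S ≤ M ^ s := by
  rcases hS.eq_or_lt with h0 | h0
  · rw [← h0]
    positivity
  · have h1 : S = S ^ (1 / q) * S ^ (1 / s) := by
      rw [← Real.rpow_add h0, one_div, one_div, h.inv_add_inv_eq_one, Real.rpow_one]
    have h2 : 0 < S ^ (1 / q) := by positivity
    have h3 : S ^ (1 / s) ≤ M := by
      refine le_of_mul_le_mul_left ?_ h2
      rw [← h1, mul_comm]
      exact hle
    calc S = (S ^ (1 / s)) ^ s := by
          rw [← Real.rpow_mul hS, one_div, inv_mul_cancel₀ h.symm.ne_zero, Real.rpow_one]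
      _ ≤ M ^ s := by
          gcongr
          exact h.symm.nonneg

/-- Every entry is at most `‖x‖_q`, so for finite `r` one has `|x_i|^r ≤ |x_i|^q ‖x‖_q^{r-q}`. -/
theorem Ell.norm_le_of_exponent_le {q r : ℝ≥0∞} [Fact (1 ≤ q)] [Fact (1 ≤ r)] (hqr : q ≤ r)
    (x : Ell q) (y : Ell r) (h : ∀ i, x i = y i) : ‖y‖ ≤ ‖x‖ := by
  have hq0 : q ≠ 0 := (zero_lt_one.trans_le (Fact.out : 1 ≤ q)).ne'
  have hr0 : r ≠ 0 := (zero_lt_one.trans_le (Fact.out : 1 ≤ r)).ne'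
  have hb : ∀ i, ‖y i‖ ≤ ‖x‖ := fun i => by
    rw [← h i]
    exact lp.norm_apply_le_norm hq0 x i
  rcases eq_or_ne r ∞ with rfl | hr
  · exact lp.norm_le_of_forall_le (norm_nonneg _) hb
  · have hq : q ≠ ∞ := ne_top_of_le_ne_top hr hqr
    have hqp : 0 < q.toReal := ENNReal.toReal_pos hq0 hq
    have hrp : 0 < r.toReal := ENNReal.toReal_pos hr0 hr
    have hle : q.toReal ≤ r.toReal := ENNReal.toReal_mono hr hqr
    refine lp.norm_le_of_forall_sum_le hrp (norm_nonneg _) fun s => ?_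
    have hsplit : ∀ t : ℝ, 0 ≤ t → t ^ r.toReal = t ^ q.toReal * t ^ (r.toReal - q.toReal) := by
      intro t ht
      rw [← Real.rpow_add_of_nonneg ht hqp.le (sub_nonneg.2 hle), add_sub_cancel]
    calc ∑ i ∈ s, ‖y i‖ ^ r.toReal
        ≤ ∑ i ∈ s, ‖x i‖ ^ q.toReal * ‖x‖ ^ (r.toReal - q.toReal) := by
          refine Finset.sum_le_sum fun i _ => ?_
          rw [hsplit _ (norm_nonneg _), h i]
          gcongr
          · exact hb i
      _ = (∑ i ∈ s, ‖x i‖ ^ q.toReal) * ‖x‖ ^ (r.toReal - q.toReal) := by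
          rw [Finset.sum_mul]
      _ ≤ ‖x‖ ^ q.toReal * ‖x‖ ^ (r.toReal - q.toReal) := by
          gcongr
          exact lp.sum_rpow_le_norm_rpow hqp x s
      _ = ‖x‖ ^ r.toReal := (hsplit _ (norm_nonneg _)).symm

/-- The inclusion `ℓ_q ⊆ ℓ_r`, for `q ≤ r`. -/
def Ell.inclusion {q r : ℝ≥0∞} [Fact (1 ≤ q)] [Fact (1 ≤ r)] (h : q ≤ r) : Ell q →L[ℂ] Ell r :=
  (lp.linearMapOfLE ℂ (fun _ : ℕ => ℂ) h).mkContinuous 1 fun x => by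
    rw [one_mul]
    exact Ell.norm_le_of_exponent_le h x _ fun _ => rfl

/-- The converse of Hölder's inequality: a sequence that defines a bounded functional on the
finitely supported sequences with the norm of `ℓ_q` lies in the dual space `ℓ_s`. -/
theorem exists_ell_of_dual_bound {q s : ℝ≥0∞} (h : q.toReal.HolderConjugate s.toReal)
    (a : ℕ → ℂ) {M : ℝ} (hM : 0 ≤ M)
    (hb : ∀ (c : ℕ → ℂ) (F : Finset ℕ),
      ‖∑ i ∈ F, c i * a i‖ ≤ M * ‖∑ i ∈ F, (lp.single q i (c i) : Ell q)‖) :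
    ∃ y : Ell s, (∀ i, y i = a i) ∧ ‖y‖ ≤ M := by
  have key : ∀ F : Finset ℕ, ∑ i ∈ F, ‖a i‖ ^ s.toReal ≤ M ^ s.toReal := by
    intro F
    -- The extremal sequence for Hölder: `c_i a_i = |c_i|^q = |a_i|^s`. Where `a_i = 0` the first
    -- factor vanishes, so the value of the power is irrelevant.
    set c : ℕ → ℂ := fun i => starRingEnd ℂ (a i) * ((‖a i‖ ^ (s.toReal - 2) : ℝ) : ℂ) with hc
    have h1 : ∀ i, c i * a i = ((‖a i‖ ^ s.toReal : ℝ) : ℂ) := by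
      intro i
      rcases eq_or_ne (a i) 0 with h0 | h0
      · simp [h0, Real.zero_rpow h.symm.ne_zero]
      · have h0' : 0 < ‖a i‖ := norm_pos_iff.2 h0
        have : (‖a i‖ ^ s.toReal : ℝ) = ‖a i‖ ^ (s.toReal - 2) * ‖a i‖ ^ 2 := by
          rw [← Real.rpow_natCast, ← Real.rpow_add h0']
          norm_num
        rw [this, hc]
        push_cast
        rw [← Complex.conj_mul']
        ring
    have h2 : ∀ i, ‖c i‖ ^ q.toReal = ‖a i‖ ^ s.toReal := by
      intro i
      rcases eq_or_ne (a i) 0 with h0 | h0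
      · simp [hc, h0, Real.zero_rpow h.symm.ne_zero, Real.zero_rpow h.ne_zero]
      · have h0' : 0 < ‖a i‖ := norm_pos_iff.2 h0
        have : ‖c i‖ = ‖a i‖ ^ (s.toReal - 1) := by
          rw [hc]
          simp only [norm_mul, RCLike.norm_conj, Complex.norm_real]
          rw [Real.norm_of_nonneg (by positivity)]
          nth_rewrite 1 [← Real.rpow_one ‖a i‖]
          rw [← Real.rpow_add h0']
          congr 1
          ring
        rw [this, ← Real.rpow_mul h0'.le, h.symm.sub_one_mul_conj]
    have h3 := hb c F
    have h4 : ‖∑ i ∈ F, (lp.single q i (c i) : Ell q)‖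
        = (∑ i ∈ F, ‖a i‖ ^ s.toReal) ^ (1 / q.toReal) := by
      have h5 := lp.norm_sum_single h.pos c F
      rw [Finset.sum_congr rfl fun i _ => h2 i] at h5
      rw [← h5, ← Real.rpow_mul (lp.norm_nonneg' _), mul_one_div_cancel h.ne_zero, Real.rpow_one]
    rw [Finset.sum_congr rfl fun i _ => h1 i, ← Complex.ofReal_sum, Complex.norm_real,
      Real.norm_of_nonneg (by positivity), h4] at h3
    exact le_rpow_of_le_mul_rpow h (by positivity) hM h3
  have hmem : Memℓp a s := memℓp_gen' key
  exact ⟨⟨a, hmem⟩, fun _ => rfl, lp.norm_le_of_forall_sum_le h.symm.pos hM key⟩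

/-! ### Hardy's inequality -/

/-- With consecutive averages `y`, `x` one has `a_N = (N+1)x - Ny`, and Young's inequality bounds `q
x^{q-1} y` by `(q-1)x^q + y^q`. The boundary term on the left is exactly what makes the induction
telescope. -/
theorem hardy_sum_le {q : ℝ} (hq : 1 < q) (a : ℕ → ℝ) (ha : ∀ n, 0 ≤ a n) (N : ℕ) :
    (q - 1) * ∑ n ∈ Finset.range N, ((∑ k ∈ Finset.range (n + 1), a k) / ((n : ℝ) + 1)) ^ q
      + N * ((∑ k ∈ Finset.range N, a k) / N) ^ q
    ≤ q * ∑ n ∈ Finset.range N,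
        ((∑ k ∈ Finset.range (n + 1), a k) / ((n : ℝ) + 1)) ^ (q - 1) * a n := by
  have hc : q.HolderConjugate (q.conjExponent) := Real.HolderConjugate.conjExponent hq
  induction N with
  | zero => simp
  | succ N ih =>
    rw [Finset.sum_range_succ
        (fun n : ℕ => ((∑ k ∈ Finset.range (n + 1), a k) / ((n : ℝ) + 1)) ^ q),
      Finset.sum_range_succ
        (fun n : ℕ => ((∑ k ∈ Finset.range (n + 1), a k) / ((n : ℝ) + 1)) ^ (q - 1) * a n),
      Nat.cast_add_one]
    set x := (∑ k ∈ Finset.range (N + 1), a k) / ((N : ℝ) + 1) with hx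
    -- For `N = 0` this is `0 / 0 = 0`; it only occurs multiplied by `N`.
    set y := (∑ k ∈ Finset.range N, a k) / (N : ℝ) with hy
    have hx0 : 0 ≤ x := div_nonneg (Finset.sum_nonneg fun _ _ => ha _) (by positivity)
    have hy0 : 0 ≤ y := div_nonneg (Finset.sum_nonneg fun _ _ => ha _) (by positivity)
    have haN : a N = (N + 1) * x - N * y := by
      have h1 : ((N : ℝ) + 1) * x = ∑ k ∈ Finset.range (N + 1), a k := by
        rw [hx]
        field_simp
      have h2 : (N : ℝ) * y = ∑ k ∈ Finset.range N, a k := by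
        rcases Nat.eq_zero_or_pos N with h0 | h0
        · simp [h0]
        · rw [hy]
          field_simp
      rw [h1, h2, Finset.sum_range_succ]
      ring
    have hyoung : q * (x ^ (q - 1) * y) ≤ (q - 1) * x ^ q + y ^ q := by
      have h1 := Real.young_inequality_of_nonneg (Real.rpow_nonneg hx0 (q - 1)) hy0 hc.symm
      rw [← Real.rpow_mul hx0, hc.sub_one_mul_conj] at h1
      have h2 : q / q.conjExponent = q - 1 := by
        rw [Real.conjExponent]
        have : q - 1 ≠ 0 := by linarith
        field_simp
      calc q * (x ^ (q - 1) * y) ≤ q * (x ^ q / q.conjExponent + y ^ q / q) := by gcongr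
        _ = q / q.conjExponent * x ^ q + y ^ q := by
          have : q ≠ 0 := by linarith
          field_simp
        _ = _ := by rw [h2]
    have hxq : x ^ (q - 1) * x = x ^ q := by
      nth_rewrite 2 [← Real.rpow_one x]
      rw [← Real.rpow_add_of_nonneg hx0 (by linarith) zero_le_one]
      congr 1
      ring
    have hN : (0 : ℝ) ≤ N := Nat.cast_nonneg N
    have h3 : q * (x ^ (q - 1) * a N)
        = q * (N + 1) * x ^ q - N * (q * (x ^ (q - 1) * y)) := by
      rw [haN, ← hxq]
      ring
    have h4 := mul_le_mul_of_nonneg_left hyoung hN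
    rw [mul_add q, h3]
    linarith

/-- After dropping the boundary term, Hölder bounds `∑ A^{q-1} a` by a power of `∑ A^q` with
exponent below `1`, which is absorbed on the left. -/
theorem hardy_finite {q : ℝ} (hq : 1 < q) (a : ℕ → ℝ) (ha : ∀ n, 0 ≤ a n) (N : ℕ) :
    ∑ n ∈ Finset.range N, ((∑ k ∈ Finset.range (n + 1), a k) / ((n : ℝ) + 1)) ^ q
    ≤ (q / (q - 1) * (∑ n ∈ Finset.range N, a n ^ q) ^ (1 / q)) ^ q := by
  have hc : q.HolderConjugate (q.conjExponent) := Real.HolderConjugate.conjExponent hq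
  set A : ℕ → ℝ := fun n => (∑ k ∈ Finset.range (n + 1), a k) / ((n : ℝ) + 1) with hA
  have hA0 : ∀ n, 0 ≤ A n := fun n =>
    div_nonneg (Finset.sum_nonneg fun _ _ => ha _) (by positivity)
  have h1 := hardy_sum_le hq a ha N
  have h2 : 0 ≤ (N : ℝ) * ((∑ k ∈ Finset.range N, a k) / N) ^ q :=
    mul_nonneg (Nat.cast_nonneg N) (Real.rpow_nonneg
      (div_nonneg (Finset.sum_nonneg fun _ _ => ha _) (Nat.cast_nonneg N)) _)
  have h3 : ∑ n ∈ Finset.range N, A n ^ (q - 1) * a n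
      ≤ (∑ n ∈ Finset.range N, A n ^ q) ^ (1 / q.conjExponent)
        * (∑ n ∈ Finset.range N, a n ^ q) ^ (1 / q) := by
    have := Real.inner_le_Lp_mul_Lq_of_nonneg (Finset.range N) hc.symm
      (f := fun n => A n ^ (q - 1)) (g := a) (fun n _ => Real.rpow_nonneg (hA0 n) _)
      (fun n _ => ha n)
    simpa only [← Real.rpow_mul (hA0 _), hc.sub_one_mul_conj] using this
  have hq1 : 0 < q - 1 := by linarith
  have hq0 : 0 < q := by linarith
  have hR : 0 ≤ ∑ n ∈ Finset.range N, a n ^ q :=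
    Finset.sum_nonneg fun n _ => Real.rpow_nonneg (ha n) _
  have hS : 0 ≤ ∑ n ∈ Finset.range N, A n ^ q :=
    Finset.sum_nonneg fun n _ => Real.rpow_nonneg (hA0 n) _
  refine le_rpow_of_le_mul_rpow hc.symm hS (by positivity) ?_
  have h5 : (q - 1) * ∑ n ∈ Finset.range N, A n ^ q
      ≤ q * ((∑ n ∈ Finset.range N, A n ^ q) ^ (1 / q.conjExponent)
        * (∑ n ∈ Finset.range N, a n ^ q) ^ (1 / q)) := by
    calc _ ≤ q * ∑ n ∈ Finset.range N, A n ^ (q - 1) * a n := by linarith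
      _ ≤ _ := by gcongr
  rw [div_mul_eq_mul_div, div_mul_eq_mul_div, le_div_iff₀ hq1]
  linarith

theorem norm_absSeq (x : ℕ → ℂ) (n : ℕ) : ‖absSeq x n‖ = ‖x n‖ := by
  rw [absSeq, Complex.norm_real, norm_norm]

theorem norm_cesaro_le (x : ℕ → ℂ) (n : ℕ) : ‖cesaro x n‖ ≤ ‖cesaro (absSeq x) n‖ := by
  rw [norm_cesaro_absSeq]
  have h : cesaro x n = (∑ k ∈ Finset.range (n + 1), x k) / ((n : ℂ) + 1) := rfl
  have h2 : ‖((n : ℂ) + 1)‖ = (n : ℝ) + 1 := by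
    rw [← Nat.cast_add_one, Complex.norm_natCast]
    push_cast
    ring
  rw [h, norm_div, h2]
  gcongr
  exact norm_sum_le _ _

theorem hardy {q : ℝ≥0∞} (h1 : 1 < q) (hq : q ≠ ∞) (x : Ell q) :
    ∃ y : Ell q, (y : ℕ → ℂ) = cesaro (absSeq x) ∧
      ‖y‖ ≤ q.toReal / (q.toReal - 1) * ‖x‖ := by
  have hq1 : 1 < q.toReal := by
    rwa [← ENNReal.toReal_one, ENNReal.toReal_lt_toReal ENNReal.one_ne_top hq]
  have hq0 : 0 < q.toReal := by linarith
  have hq2 : 0 < q.toReal - 1 := by linarith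
  have key : ∀ s : Finset ℕ, ∑ n ∈ s, ‖cesaro (absSeq x) n‖ ^ q.toReal
      ≤ (q.toReal / (q.toReal - 1) * ‖x‖) ^ q.toReal := by
    intro s
    obtain ⟨N, hN⟩ := s.exists_nat_subset_range
    calc ∑ n ∈ s, ‖cesaro (absSeq x) n‖ ^ q.toReal
        ≤ ∑ n ∈ Finset.range N, ‖cesaro (absSeq x) n‖ ^ q.toReal :=
          Finset.sum_le_sum_of_subset_of_nonneg hN fun _ _ _ => by positivity
      _ ≤ (q.toReal / (q.toReal - 1) *
            (∑ n ∈ Finset.range N, ‖x n‖ ^ q.toReal) ^ (1 / q.toReal)) ^ q.toReal := by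
          simp only [norm_cesaro_absSeq]
          exact hardy_finite hq1 _ (fun _ => norm_nonneg _) N
      _ ≤ _ := by
          gcongr
          calc _ ≤ (‖x‖ ^ q.toReal) ^ (1 / q.toReal) := by
                gcongr
                exact lp.sum_rpow_le_norm_rpow hq0 x _
            _ = ‖x‖ := by
                rw [← Real.rpow_mul (lp.norm_nonneg' _), mul_one_div_cancel hq0.ne', Real.rpow_one]
  exact ⟨⟨_, memℓp_gen' key⟩, rfl, lp.norm_le_of_forall_sum_le hq0
    (mul_nonneg (by positivity) (lp.norm_nonneg' _)) key⟩

/-- Averages of nonnegative terms decay slowly: each of the `n + 1` entries of `C(|x|)` with index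
in `[n, 2n]` is at least `S / (2n+1)`, so their average up to `2n` is at least `(n+1) S / (2n+1)²`,
and `(2n+2)² ≥ (2n+1)²`. -/
theorem norm_cesaro_absSeq_le_four_mul (x : ℕ → ℂ) (n : ℕ) :
    ‖cesaro (absSeq x) n‖ ≤ 4 * ‖cesaro (cesaro (absSeq x)) (2 * n)‖ := by
  have habs : absSeq (cesaro (absSeq x)) = cesaro (absSeq x) := by
    funext k
    rw [absSeq, norm_cesaro_absSeq]
    simp [cesaro, absSeq]
  have h1 : ‖cesaro (cesaro (absSeq x)) (2 * n)‖
      = (∑ k ∈ Finset.range (2 * n + 1), ‖cesaro (absSeq x) k‖) / (((2 * n : ℕ) : ℝ) + 1) := by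
    rw [← norm_cesaro_absSeq, habs]
  set S := ∑ k ∈ Finset.range (n + 1), ‖x k‖ with hS
  have hS0 : 0 ≤ S := Finset.sum_nonneg fun _ _ => norm_nonneg _
  have h2 : ((n : ℝ) + 1) * (S / (2 * n + 1))
      ≤ ∑ k ∈ Finset.range (2 * n + 1), ‖cesaro (absSeq x) k‖ := by
    calc ((n : ℝ) + 1) * (S / (2 * n + 1))
        = ∑ _k ∈ Finset.Ico n (2 * n + 1), S / (2 * n + 1) := by
          rw [Finset.sum_const, Nat.card_Ico, nsmul_eq_mul]
          congr 1
          rw [show 2 * n + 1 - n = n + 1 by omega]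
          push_cast
          ring
      _ ≤ ∑ k ∈ Finset.Ico n (2 * n + 1), ‖cesaro (absSeq x) k‖ := by
          refine Finset.sum_le_sum fun k hk => ?_
          rw [Finset.mem_Ico] at hk
          rw [norm_cesaro_absSeq]
          have hk2 : (k : ℝ) + 1 ≤ 2 * n + 1 := by
            have : (k : ℝ) ≤ 2 * n := by exact_mod_cast Nat.lt_succ_iff.1 hk.2
            linarith
          refine div_le_div₀ (Finset.sum_nonneg fun _ _ => norm_nonneg _) ?_ (by positivity) hk2
          refine Finset.sum_le_sum_of_subset_of_nonneg ?_ fun _ _ _ => norm_nonneg _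
          intro i hi
          rw [Finset.mem_range] at hi ⊢
          omega
      _ ≤ _ := by
          refine Finset.sum_le_sum_of_subset_of_nonneg ?_ fun _ _ _ => norm_nonneg _
          intro i hi
          rw [Finset.mem_Ico] at hi
          exact Finset.mem_range.2 hi.2
  rw [norm_cesaro_absSeq, h1, ← hS]
  have hn : (0 : ℝ) ≤ n := Nat.cast_nonneg n
  push_cast
  calc S / ((n : ℝ) + 1) ≤ 4 * (((n : ℝ) + 1) * (S / (2 * n + 1)) / (2 * n + 1)) := by
        rw [div_le_iff₀ (by positivity)]
        have : 4 * (((n : ℝ) + 1) * (S / (2 * n + 1)) / (2 * n + 1)) * (n + 1)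
            = S * ((2 * (n + 1)) ^ 2 / (2 * n + 1) ^ 2) := by
          field_simp
          ring
        rw [this]
        refine le_mul_of_one_le_right hS0 ?_
        rw [one_le_div (by positivity)]
        gcongr
        linarith
    _ ≤ _ := by gcongr

theorem memℓp_cesaro_of_memℓp_cesaro_cesaro {q : ℝ≥0∞} (hq0 : q ≠ 0) (hq : q ≠ ∞) {x : ℕ → ℂ}
    (h : Memℓp (cesaro (cesaro (absSeq x))) q) : Memℓp (cesaro (absSeq x)) q := by
  have hqp : 0 < q.toReal := ENNReal.toReal_pos hq0 hq
  have hinj : Function.Injective fun n : ℕ => 2 * n := fun a b hab => by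
    simpa using hab
  have h1 : Memℓp (fun n => cesaro (cesaro (absSeq x)) (2 * n)) q :=
    memℓp_gen ((h.summable hqp).comp_injective hinj)
  refine memℓp_of_norm_le (h1.const_smul (4 : ℂ)) fun n => ?_
  rw [Pi.smul_apply, norm_smul]
  simpa using norm_cesaro_absSeq_le_four_mul x n

/-! ### Locally convex inductive limits -/

section IndLim

variable {ι : Type*} {E : ι → Type*} [∀ i, AddCommGroup (E i)] [∀ i, Module ℂ (E i)]
  [∀ i, TopologicalSpace (E i)] {V : Type*} [AddCommGroup V] [Module ℂ V] (j : ∀ i, E i →ₗ[ℂ] V)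

theorem indLimTopology_isTopologicalAddGroup : @IsTopologicalAddGroup V (indLimTopology j) _ :=
  topologicalAddGroup_sInf fun _ ht => ht.1

theorem indLimTopology_continuousSMul : @ContinuousSMul ℂ V _ _ (indLimTopology j) :=
  continuousSMul_sInf fun _ ht => ht.2.1

theorem indLimTopology_locallyConvexSpace :
    @LocallyConvexSpace ℝ V _ _ _ _ (indLimTopology j) :=
  LocallyConvexSpace.sInf fun _ ht => ht.2.2.1

theorem continuous_indLimTopology (i : ι) : @Continuous (E i) V _ (indLimTopology j) (j i) :=
  continuous_sInf_rng.2 fun _ ht => ht.2.2.2 i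

theorem indLimTopology_le {t : TopologicalSpace V} (h1 : @IsTopologicalAddGroup V t _)
    (h2 : @ContinuousSMul ℂ V _ _ t) (h3 : @LocallyConvexSpace ℝ V _ _ _ _ t)
    (h4 : ∀ i, @Continuous (E i) V _ t (j i)) : indLimTopology j ≤ t :=
  sInf_le ⟨h1, h2, h3, h4⟩

/-- The universal property of the locally convex inductive limit. -/
theorem continuous_of_indLimTopology {W : Type*} [AddCommGroup W] [Module ℂ W]
    [TopologicalSpace W] [IsTopologicalAddGroup W] [ContinuousSMul ℂ W] [LocallyConvexSpace ℝ W]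
    (f : V →ₗ[ℂ] W) (h : ∀ i, Continuous fun x => f (j i x)) :
    @Continuous V W (indLimTopology j) _ f := by
  rw [continuous_iff_le_induced]
  refine indLimTopology_le j (topologicalAddGroup_induced f) (continuousSMul_induced f) ?_ ?_
  · exact LocallyConvexSpace.induced (f.restrictScalars ℝ)
  · exact fun i => continuous_induced_rng.2 (h i)

theorem continuous_of_indLimTopology_normedSpace {W : Type*} [NormedAddCommGroup W]
    [NormedSpace ℂ W] (f : V →ₗ[ℂ] W) (h : ∀ i, Continuous fun x => f (j i x)) :
    @Continuous V W (indLimTopology j) _ f :=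
  have : LocallyConvexSpace ℝ W := NormedSpace.toLocallyConvexSpace' ℂ
  continuous_of_indLimTopology j f h

/-- The topology defined by `s` alone is one of the competitors in the infimum defining the limit
topology. -/
theorem Seminorm.continuous_indLimTopology (s : Seminorm ℂ V)
    (h : ∀ i, Continuous fun x => s (j i x)) [∀ i, IsTopologicalAddGroup (E i)] :
    @Continuous V ℝ (indLimTopology j) _ s := by
  let t : TopologicalSpace V := (SeminormFamily.moduleFilterBasis (fun _ : Unit => s)).topology
  have hs : WithSeminorms (fun _ : Unit => s) := ⟨rfl⟩
  refine continuous_le_dom (indLimTopology_le j (t := t) hs.topologicalAddGroup hs.continuousSMul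
    hs.toLocallyConvexSpace fun i => ?_) (hs.continuous_seminorm ())
  exact hs.continuous_of_continuous_comp (j i) fun _ => h i

end IndLim

/-- An absolutely convex set which meets every step in a neighbourhood of `0` is a neighbourhood of
`0` in the inductive limit. -/
theorem indLimTopology_mem_nhds_zero {ι : Type*} {E : ι → Type*} [∀ i, NormedAddCommGroup (E i)]
    [∀ i, NormedSpace ℂ (E i)] {V : Type*} [AddCommGroup V] [Module ℂ V] (j : ∀ i, E i →ₗ[ℂ] V)
    (hj : ∀ v, ∃ i x, j i x = v) {W : Set V} (hb : Balanced ℂ W) (hc : Convex ℝ W)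
    (hW : ∀ i, j i ⁻¹' W ∈ 𝓝 (0 : E i)) : W ∈ @nhds V (indLimTopology j) 0 := by
  have habs : Absorbent ℝ W := by
    intro v
    obtain ⟨i, x, rfl⟩ := hj v
    filter_upwards [absorbent_nhds_zero (𝕜 := ℝ) (hW i) x] with r hr
    rw [Set.singleton_subset_iff] at hr ⊢
    obtain ⟨y, hy, hyx⟩ := hr
    refine ⟨j i y, hy, ?_⟩
    rw [← hyx]
    exact ((j i).restrictScalars ℝ).map_smul r y |>.symm
  have h0 : (0 : V) ∈ W := habs.zero_mem
  -- The gauge of `W` is at most `1` on a neighbourhood of `0` in each step, hence continuous on the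
  -- limit; its open unit ball lies in `W`.
  have hcont : @Continuous V ℝ (indLimTopology j) _ (gaugeSeminorm hb hc habs) := by
    refine Seminorm.continuous_indLimTopology j _ fun i => ?_
    refine Seminorm.continuous' (p := (gaugeSeminorm hb hc habs).comp (j i)) (r := 1) ?_
    refine Filter.mem_of_superset (hW i) fun x hx => ?_
    rw [Seminorm.mem_closedBall_zero]
    exact gauge_le_one_of_mem hx
  let t := indLimTopology j
  have h1 : {v | gaugeSeminorm hb hc habs v < 1} ∈ 𝓝 (0 : V) :=
    (isOpen_lt hcont continuous_const).mem_nhds (by simp)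
  exact Filter.mem_of_superset h1 (setOfPred_gauge_lt_one_subset_self hc h0 habs)

/-! ### The spaces `ℓ_{p-}` and `ces(p-)` -/

theorem ExpBelow.ne_zero {p : ℝ≥0∞} (q : ExpBelow p) : q.1 ≠ 0 := (zero_lt_one.trans q.2.1).ne'

theorem ExpBelow.ne_top {p : ℝ≥0∞} (q : ExpBelow p) : q.1 ≠ ∞ := (q.2.2.trans_le le_top).ne

section Minus

variable {p : ℝ≥0∞} [Fact (1 < p)]

instance : IsTopologicalAddGroup (EllMinus p) := indLimTopology_isTopologicalAddGroup _

instance : ContinuousSMul ℂ (EllMinus p) := indLimTopology_continuousSMul _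

instance : LocallyConvexSpace ℝ (EllMinus p) := indLimTopology_locallyConvexSpace _

instance : IsTopologicalAddGroup (CesMinus p) := indLimTopology_isTopologicalAddGroup _

instance : ContinuousSMul ℂ (CesMinus p) := indLimTopology_continuousSMul _

instance : LocallyConvexSpace ℝ (CesMinus p) := indLimTopology_locallyConvexSpace _

/-- An exponent below `p` is below every `q ≥ p`. -/
def ExpBelow.mono {p q : ℝ≥0∞} (h : p ≤ q) (r : ExpBelow p) : ExpBelow q :=
  ⟨r.1, r.2.1, r.2.2.trans_le h⟩

theorem EllMinus.continuous_incl (q : ExpBelow p) : Continuous (EllMinus.incl q) :=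
  continuous_indLimTopology EllMinus.incl q

theorem CesMinus.continuous_incl (q : ExpBelow p) : Continuous (CesMinus.incl q) :=
  continuous_indLimTopology CesMinus.incl q

theorem EllMinus.exists_incl (v : EllMinus p) : ∃ (q : ExpBelow p) (x : Ell q.1), incl q x = v := by
  obtain ⟨x, q, hq⟩ := v
  exact ⟨q, ⟨x, hq⟩, rfl⟩

theorem EllMinus.toSeq_injective : Function.Injective (toSeq : EllMinus p → ℕ → ℂ) :=
  Subtype.coe_injective

theorem EllMinus.incl_injective (q : ExpBelow p) : Function.Injective (incl q) := fun _ _ h =>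
  lp.ext (congrArg toSeq h)

theorem EllMinus.incl_inclusion {q r : ExpBelow p} (h : q.1 ≤ r.1) (x : Ell q.1) :
    incl r (Ell.inclusion h x) = incl q x := rfl

/-- The inclusion `ℓ_{p-} ⊆ ℓ_∞`, as a linear map. -/
def EllMinus.toEllInftyₗ : EllMinus p →ₗ[ℂ] Ell ∞ where
  toFun v := ⟨toSeq v, by
    obtain ⟨q, hq⟩ := v.2
    exact hq.of_exponent_ge le_top⟩
  map_add' _ _ := rfl
  map_smul' _ _ := rfl

/-- The continuous inclusion `ℓ_{p-} ⊆ ℓ_∞`. -/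
def EllMinus.toEllInfty : EllMinus p →L[ℂ] Ell ∞ where
  toLinearMap := toEllInftyₗ
  cont := continuous_of_indLimTopology_normedSpace EllMinus.incl toEllInftyₗ
    fun q => (Ell.inclusion (q := q.1) le_top).continuous

instance : T2Space (EllMinus p) :=
  T2Space.of_injective_continuous
    (fun _ _ h => EllMinus.toSeq_injective (congrArg (fun z : Ell ∞ => (z : ℕ → ℂ)) h))
    (EllMinus.toEllInfty (p := p)).continuous

/-! ### Inclusions and Cesàro operators, on the steps and on the limits -/

theorem Ces.norm_toEll_le {q : ℝ≥0∞} [Fact (1 ≤ q)] (x : Ces q) (y : Ell q)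
    (h : (y : ℕ → ℂ) = cesaro (Ces.toSeq x)) : ‖y‖ ≤ ‖x‖ := by
  rw [Ces.norm_def]
  refine lp.norm_mono (zero_lt_one.trans_le (Fact.out : 1 ≤ q)).ne' fun n => ?_
  rw [h]
  exact norm_cesaro_le _ n

/-- The Cesàro operator `ces(q) → ℓ_q`. -/
def Ces.cesaroCLM (q : ℝ≥0∞) [Fact (1 ≤ q)] : Ces q →L[ℂ] Ell q :=
  LinearMap.mkContinuous
    { toFun x := ⟨cesaro (toSeq x), memℓp_of_norm_le x.2 (norm_cesaro_le _)⟩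
      map_add' x y := lp.ext (cesaro.map_add (toSeq x) (toSeq y))
      map_smul' c x := lp.ext (cesaro.map_smul c (toSeq x)) } 1 fun x => by
    rw [one_mul]
    exact norm_toEll_le x _ rfl

theorem mem_ces_of_memℓp {q : ℝ≥0∞} (h1 : 1 < q) (hq : q ≠ ∞) {x : ℕ → ℂ} (hx : Memℓp x q) :
    x ∈ ces q := by
  obtain ⟨y, hy, -⟩ := hardy h1 hq ⟨x, hx⟩
  have h2 := lp.memℓp y
  rw [hy] at h2
  exact h2

/-- A sequence `x` with `C(|x|) ∈ ℓ_q`, as an element of `ces(q)`. -/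
def Ces.mk {q : ℝ≥0∞} (x : ℕ → ℂ) (hx : x ∈ ces q) : Ces q := (⟨x, hx⟩ : ces q)

theorem Ces.toSeq_mk {q : ℝ≥0∞} (x : ℕ → ℂ) (hx : x ∈ ces q) : toSeq (mk x hx) = x := rfl

/-- The inclusion `ℓ_q ⊆ ces(q)`, for `1 < q < ∞`, as a linear map. -/
def Ell.toCesₗ {q : ℝ≥0∞} (h1 : 1 < q) (hq : q ≠ ∞) : Ell q →ₗ[ℂ] Ces q where
  toFun x := Ces.mk x (mem_ces_of_memℓp h1 hq (lp.memℓp x))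
  map_add' _ _ := rfl
  map_smul' _ _ := rfl

theorem Ell.toSeq_toCesₗ {q : ℝ≥0∞} (h1 : 1 < q) (hq : q ≠ ∞) (x : Ell q) :
    Ces.toSeq (Ell.toCesₗ h1 hq x) = x := Ces.toSeq_mk _ _

theorem Ell.norm_toCesₗ_le {q : ℝ≥0∞} [Fact (1 ≤ q)] (h1 : 1 < q) (hq : q ≠ ∞) (x : Ell q) :
    ‖Ell.toCesₗ h1 hq x‖ ≤ q.toReal / (q.toReal - 1) * ‖x‖ := by
  obtain ⟨y, hy, hle⟩ := hardy h1 hq x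
  have h2 : Ces.cesaroAbs (Ell.toCesₗ h1 hq x) = y := by
    apply lp.ext
    rw [hy, Ces.coe_cesaroAbs, Ell.toSeq_toCesₗ]
  rw [Ces.norm_def, h2]
  exact hle

/-- The inclusion `ℓ_q ⊆ ces(q)`, for `1 < q < ∞`. -/
def Ell.toCes {q : ℝ≥0∞} [Fact (1 ≤ q)] (h1 : 1 < q) (hq : q ≠ ∞) : Ell q →L[ℂ] Ces q :=
  (Ell.toCesₗ h1 hq).mkContinuous _ (Ell.norm_toCesₗ_le h1 hq)

theorem ellMinus_mono {p q : ℝ≥0∞} [Fact (1 < p)] [Fact (1 < q)] (h : p ≤ q) :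
    ellMinus p ≤ ellMinus q := fun _ ⟨r, hr⟩ => ⟨r.mono h, hr⟩

theorem ellMinus_le_cesMinus {p q : ℝ≥0∞} [Fact (1 < p)] [Fact (1 < q)] (h : p ≤ q) :
    ellMinus p ≤ cesMinus q := fun _ ⟨r, hr⟩ =>
  ⟨r.mono h, mem_ces_of_memℓp r.2.1 r.ne_top hr⟩

theorem cesaro_mem_ellMinus {p q : ℝ≥0∞} [Fact (1 < p)] [Fact (1 < q)] (h : p ≤ q) {x : ℕ → ℂ}
    (hx : x ∈ cesMinus p) : cesaro x ∈ ellMinus q := by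
  obtain ⟨r, hr⟩ := hx
  exact ⟨r.mono h, memℓp_of_norm_le hr (norm_cesaro_le x)⟩

/-- The inclusion `ℓ_{p-} ⊆ ℓ_{q-}`, as a linear map. -/
def EllMinus.inclusionₗ {p q : ℝ≥0∞} [Fact (1 < p)] [Fact (1 < q)] (h : p ≤ q) :
    EllMinus p →ₗ[ℂ] EllMinus q :=
  (Submodule.inclusion (ellMinus_mono h) : ellMinus p →ₗ[ℂ] ellMinus q)

/-- The continuous inclusion `ℓ_{p-} ⊆ ℓ_{q-}`. -/
def EllMinus.inclusion {p q : ℝ≥0∞} [Fact (1 < p)] [Fact (1 < q)] (h : p ≤ q) :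
    EllMinus p →L[ℂ] EllMinus q where
  toLinearMap := EllMinus.inclusionₗ h
  cont := continuous_of_indLimTopology EllMinus.incl (EllMinus.inclusionₗ h)
    fun r => EllMinus.continuous_incl (r.mono h)

/-- The inclusion `ℓ_{p-} ⊆ ces(q-)`, as a linear map. -/
def EllMinus.toCesMinusₗ {p q : ℝ≥0∞} [Fact (1 < p)] [Fact (1 < q)] (h : p ≤ q) :
    EllMinus p →ₗ[ℂ] CesMinus q :=
  (Submodule.inclusion (ellMinus_le_cesMinus h) : ellMinus p →ₗ[ℂ] cesMinus q)

/-- The continuous inclusion `ℓ_{p-} ⊆ ces(q-)`. -/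
def EllMinus.toCesMinus {p q : ℝ≥0∞} [Fact (1 < p)] [Fact (1 < q)] (h : p ≤ q) :
    EllMinus p →L[ℂ] CesMinus q where
  toLinearMap := EllMinus.toCesMinusₗ h
  cont := continuous_of_indLimTopology EllMinus.incl (EllMinus.toCesMinusₗ h)
    fun r => (CesMinus.continuous_incl (r.mono h)).comp
      (Ell.toCes (q := r.1) r.2.1 r.ne_top).continuous

/-- The Cesàro operator `ces(p-) → ℓ_{q-}`, as a linear map. -/
def CesMinus.cesaroₗ {p q : ℝ≥0∞} [Fact (1 < p)] [Fact (1 < q)] (h : p ≤ q) :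
    CesMinus p →ₗ[ℂ] EllMinus q :=
  (cesaro.restrict fun _ hx => cesaro_mem_ellMinus h hx : cesMinus p →ₗ[ℂ] ellMinus q)

/-- The Cesàro operator `ces(p-) → ℓ_{q-}`. -/
def CesMinus.cesaroCLM {p q : ℝ≥0∞} [Fact (1 < p)] [Fact (1 < q)] (h : p ≤ q) :
    CesMinus p →L[ℂ] EllMinus q where
  toLinearMap := CesMinus.cesaroₗ h
  cont := continuous_of_indLimTopology CesMinus.incl (CesMinus.cesaroₗ h) fun r =>
    (EllMinus.continuous_incl (r.mono h)).comp (Ces.cesaroCLM r.1).continuous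

/-! ### Strictness of the inclusions -/

theorem ellMinus_lt_ellMinus {p q : ℝ≥0∞} [Fact (1 < p)] [Fact (1 < q)] (h : p < q) :
    ellMinus p < ellMinus q := by
  refine lt_of_le_not_ge (ellMinus_mono h.le) fun hle => ?_
  have hp1 : 1 < p := Fact.out
  have hptop : p ≠ ∞ := (h.trans_le le_top).ne
  have hpR : 0 < p.toReal := ENNReal.toReal_pos (zero_lt_one.trans hp1).ne' hptop
  obtain ⟨r, hpr, hrq⟩ := exists_between h
  have hrtop : r ≠ ∞ := (hrq.trans_le le_top).ne
  have hrR : p.toReal < r.toReal := (ENNReal.toReal_lt_toReal hptop hrtop).2 hpr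
  -- The critical power for `ℓ_p`: for finite `s` this sequence is in `ℓ_s` exactly when `s > p`.
  set x : ℕ → ℂ := fun n => ((((n : ℝ) + 1) ^ (-(1 / p.toReal)) : ℝ) : ℂ) with hx
  have hnorm : ∀ (s : ℝ) (n : ℕ), ‖x n‖ ^ s = (((n + 1 : ℕ) : ℝ) ^ (s / p.toReal))⁻¹ := by
    intro s n
    have h0 : (0 : ℝ) ≤ (n : ℝ) + 1 := by positivity
    rw [hx, Complex.norm_real, Real.norm_of_nonneg (by positivity), ← Real.rpow_mul h0,
      Nat.cast_add_one, ← Real.rpow_neg h0]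
    congr 1
    ring
  have hsum : ∀ s : ℝ, (Summable fun n => ‖x n‖ ^ s) ↔ p.toReal < s := by
    intro s
    simp only [hnorm]
    rw [summable_nat_add_iff (f := fun n : ℕ => ((n : ℝ) ^ (s / p.toReal))⁻¹) 1,
      Real.summable_nat_rpow_inv, one_lt_div hpR]
  have hxq : x ∈ ellMinus q := ⟨⟨r, hp1.trans hpr, hrq⟩, memℓp_gen ((hsum _).2 hrR)⟩
  obtain ⟨s, hs⟩ := hle hxq
  have h1 := (hsum _).1 (hs.summable (ENNReal.toReal_pos s.ne_zero s.ne_top))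
  exact absurd h1 (not_lt.2 (ENNReal.toReal_mono hptop s.2.2.le))

open Classical in
/-- The indicator sequence of the positions `1, 2, 4, 8, …`. -/
def powTwoIndicator (k : ℕ) : ℂ := if ∃ i, k + 1 = 2 ^ i then 1 else 0

theorem sum_range_norm_powTwoIndicator_le (n : ℕ) :
    ∑ k ∈ Finset.range (n + 1), ‖powTwoIndicator k‖
      ≤ (Nat.log 2 (n + 1) : ℝ) + 1 := by
  classical
  have h1 : ∀ k : ℕ, ‖powTwoIndicator k‖
      = if ∃ i, k + 1 = 2 ^ i then (1 : ℝ) else 0 := by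
    intro k
    rw [powTwoIndicator]
    split_ifs <;> simp
  simp only [h1]
  rw [Finset.sum_boole]
  have h2 : (Finset.range (n + 1)).filter (fun k => ∃ i, k + 1 = 2 ^ i)
      ⊆ (Finset.range (Nat.log 2 (n + 1) + 1)).image fun i => 2 ^ i - 1 := by
    intro k hk
    rw [Finset.mem_filter, Finset.mem_range] at hk
    obtain ⟨hkn, i, hi⟩ := hk
    refine Finset.mem_image.2 ⟨i, Finset.mem_range.2 (Nat.lt_succ_of_le ?_), ?_⟩
    · exact Nat.le_log_of_pow_le one_lt_two (by omega)
    · omega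
  have h3 := (Finset.card_le_card h2).trans Finset.card_image_le
  rw [Finset.card_range] at h3
  exact_mod_cast h3

/-- The partial sums grow logarithmically, so the averages are `O(log n / n)`. -/
theorem powTwoIndicator_mem_ces {q : ℝ≥0∞} (h1 : 1 < q) (hq : q ≠ ∞) :
    powTwoIndicator ∈ ces q := by
  have ht : 1 < q.toReal := by
    rwa [← ENNReal.toReal_one, ENNReal.toReal_lt_toReal ENNReal.one_ne_top hq]
  set t := q.toReal with htdef
  have ht0 : 0 < t := by linarith
  -- Chosen so that `t(ε - 1) = -(t+1)/2 < -1`, where `n^ε` dominates the logarithm.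
  set ε := (t - 1) / (2 * t) with hε
  have hε0 : 0 < ε := div_pos (by linarith) (by linarith)
  have hlog2 : 0 < Real.log 2 := Real.log_pos one_lt_two
  set K := 1 / ε / Real.log 2 + 1 with hK
  have hK0 : 0 ≤ K := by positivity
  have hbound : ∀ n : ℕ,
      ‖cesaro (absSeq powTwoIndicator) n‖ ^ t
        ≤ K ^ t * (((n + 1 : ℕ) : ℝ) ^ ((t + 1) / 2))⁻¹ := by
    intro n
    have hn : (1 : ℝ) ≤ (n : ℝ) + 1 := by linarith [(Nat.cast_nonneg n : (0 : ℝ) ≤ n)]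
    have hn0 : (0 : ℝ) < (n : ℝ) + 1 := by linarith
    have e1 : (Nat.log 2 (n + 1) : ℝ) ≤ ((n : ℝ) + 1) ^ ε / ε / Real.log 2 := by
      refine (Real.natLog_le_logb (n + 1) 2).trans ?_
      rw [Real.logb]
      push_cast
      gcongr
      exact Real.log_le_rpow_div hn0.le hε0
    have e2 : ∑ k ∈ Finset.range (n + 1), ‖powTwoIndicator k‖
        ≤ K * ((n : ℝ) + 1) ^ ε := by
      refine (sum_range_norm_powTwoIndicator_le n).trans ?_
      have e3 : (1 : ℝ) ≤ ((n : ℝ) + 1) ^ ε := Real.one_le_rpow hn hε0.le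
      calc _ ≤ ((n : ℝ) + 1) ^ ε / ε / Real.log 2 + ((n : ℝ) + 1) ^ ε := add_le_add e1 e3
        _ = _ := by
          rw [hK]
          ring
    rw [norm_cesaro_absSeq]
    calc _ ≤ (K * ((n : ℝ) + 1) ^ ε / ((n : ℝ) + 1)) ^ t := by gcongr
      _ = (K * ((n : ℝ) + 1) ^ (ε - 1)) ^ t := by
        rw [Real.rpow_sub hn0, Real.rpow_one, mul_div_assoc]
      _ = K ^ t * ((n : ℝ) + 1) ^ (-((t + 1) / 2)) := by
        rw [Real.mul_rpow hK0 (by positivity), ← Real.rpow_mul hn0.le]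
        congr 2
        rw [hε]
        field_simp
        ring
      _ = _ := by rw [Real.rpow_neg hn0.le, Nat.cast_add_one]
  refine memℓp_gen (Summable.of_nonneg_of_le (fun n => by positivity) hbound
    (Summable.mul_left _ ?_))
  rw [summable_nat_add_iff (f := fun n : ℕ => ((n : ℝ) ^ ((t + 1) / 2))⁻¹) 1,
    Real.summable_nat_rpow_inv]
  linarith

theorem powTwoIndicator_not_memℓp {q : ℝ≥0∞} (h0 : q ≠ 0) (hq : q ≠ ∞) :
    ¬ Memℓp powTwoIndicator q := by
  intro h
  have hlim := (h.summable (ENNReal.toReal_pos h0 hq)).tendsto_atTop_zero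
  have hsub : Filter.Tendsto (fun i : ℕ => 2 ^ i - 1) Filter.atTop Filter.atTop :=
    (Filter.tendsto_sub_atTop_nat 1).comp (tendsto_pow_atTop_atTop_of_one_lt one_lt_two)
  have h1 := hlim.comp hsub
  have h2 : ((fun k : ℕ => ‖powTwoIndicator k‖ ^ q.toReal) ∘
      fun i : ℕ => 2 ^ i - 1) = fun _ => (1 : ℝ) := by
    funext i
    have h3 : ∃ j, 2 ^ i - 1 + 1 = 2 ^ j := ⟨i, Nat.sub_add_cancel Nat.one_le_two_pow⟩
    rw [Function.comp_apply, powTwoIndicator, if_pos h3, norm_one, Real.one_rpow]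
  rw [h2] at h1
  exact one_ne_zero (tendsto_nhds_unique tendsto_const_nhds h1)

/-- A single witness serves all exponents: sparse entries equal to `1` average to something small
but do not tend to `0`. -/
theorem ellMinus_lt_cesMinus {p q : ℝ≥0∞} [Fact (1 < p)] [Fact (1 < q)] (h : p ≤ q) :
    ellMinus p < cesMinus q := by
  refine lt_of_le_not_ge (ellMinus_le_cesMinus h) fun hle => ?_
  obtain ⟨r, hr⟩ := exists_between (Fact.out : 1 < q)
  let r' : ExpBelow q := ⟨r, hr⟩
  obtain ⟨s, hs⟩ := hle (⟨r', powTwoIndicator_mem_ces r'.2.1 r'.ne_top⟩ : _ ∈ cesMinus q)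
  exact powTwoIndicator_not_memℓp s.ne_zero s.ne_top hs

/-! ### Optimal solid domain and iterated averages -/

/-- For maximality, a solid `X` contains `|x|` along with `x`, so `C(|x|) ∈ ℓ_{p-}`. -/
theorem cesMinus_isGreatest :
    IsGreatest {X : Submodule ℂ (ℕ → ℂ) | IsSolid X ∧ ∀ x ∈ X, cesaro x ∈ ellMinus p}
      (cesMinus p) := by
  refine ⟨⟨?_, fun x hx => cesaro_mem_ellMinus le_rfl hx⟩, ?_⟩
  · rintro x ⟨q, hq⟩ y hxy
    refine ⟨q, memℓp_of_norm_le (x := cesaro (absSeq x)) hq fun n => ?_⟩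
    rw [norm_cesaro_absSeq, norm_cesaro_absSeq]
    gcongr with k _
    exact hxy k
  · rintro X ⟨hX, hC⟩ x hx
    exact hC _ (hX x hx _ fun n => (norm_absSeq x n).le)

theorem cesaro_cesaro_mem_ellMinus_iff (x : ℕ → ℂ) :
    cesaro (cesaro (absSeq x)) ∈ ellMinus p ↔ cesaro (absSeq x) ∈ ellMinus p := by
  constructor
  · rintro ⟨q, hq⟩
    exact ⟨q, memℓp_cesaro_of_memℓp_cesaro_cesaro q.ne_zero q.ne_top hq⟩
  · exact fun hx => cesaro_mem_ellMinus le_rfl (ellMinus_le_cesMinus le_rfl hx)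

end Minus

/-! ### The Fréchet spaces `ℓ_{r+}` -/

section Plus

variable {r : ℝ≥0∞}

theorem ExpAbove.nonempty (hr : r ≠ ∞) : Nonempty (ExpAbove r) := by
  obtain ⟨q, hq⟩ := exists_between hr.lt_top
  exact ⟨⟨q, hq⟩⟩

theorem ExpAbove.exists_seq (hr : r ≠ ∞) : ∃ u : ℕ → ExpAbove r,
    ∀ q : ExpAbove r, ∃ n, (u n).1 ≤ q.1 := by
  obtain ⟨u, -, hu, hlim⟩ := exists_seq_strictAnti_tendsto' hr.lt_top
  refine ⟨fun n => ⟨u n, hu n⟩, fun q => ?_⟩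
  obtain ⟨n, hn⟩ := (hlim.eventually_lt_const q.2.1).exists
  exact ⟨n, hn.le⟩

/-- The sequence underlying an element of `ℓ_{r+}`. -/
def EllPlus.toSeq : EllPlus r →ₗ[ℂ] (ℕ → ℂ) := (ellPlus r).subtype

theorem EllPlus.toSeq_injective : Function.Injective (toSeq : EllPlus r → ℕ → ℂ) :=
  Subtype.coe_injective

theorem single_mem_ellPlus (i : ℕ) (c : ℂ) : Pi.single i c ∈ ellPlus r := fun q => by
  have h := lp.memℓp (lp.single q.1 i c : Ell q.1)
  rwa [lp.coeFn_single] at h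

/-- The sequence with a single nonzero entry, as an element of `ℓ_{r+}`. -/
def EllPlus.single (i : ℕ) (c : ℂ) : EllPlus r :=
  (⟨Pi.single i c, single_mem_ellPlus i c⟩ : ellPlus r)

theorem EllPlus.toSeq_single (i : ℕ) (c : ℂ) :
    toSeq (single i c : EllPlus r) = Pi.single i c := rfl

theorem EllPlus.single_eq_smul (i : ℕ) (c : ℂ) :
    (single i c : EllPlus r) = c • single i 1 := by
  apply toSeq_injective
  rw [map_smul, toSeq_single, toSeq_single, ← Pi.single_smul, smul_eq_mul, mul_one]

theorem EllPlus.toEll_single (q : ExpAbove r) (i : ℕ) (c : ℂ) :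
    toEll q (single i c) = lp.single q.1 i c := by
  apply lp.ext
  rw [lp.coeFn_single]
  rfl

variable [Fact (1 ≤ r)]

instance : IsTopologicalAddGroup (EllPlus r) :=
  topologicalAddGroup_iInf fun q => topologicalAddGroup_induced (EllPlus.toEll q)

instance : ContinuousSMul ℂ (EllPlus r) :=
  continuousSMul_iInf fun q => continuousSMul_induced (EllPlus.toEll q)

theorem EllPlus.continuous_toEll (q : ExpAbove r) : Continuous (EllPlus.toEll q) :=
  continuous_iInf_dom (i := q) continuous_induced_dom

theorem EllPlus.norm_toEll_le_of_le {q s : ExpAbove r} (h : q.1 ≤ s.1) (y : EllPlus r) :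
    ‖toEll s y‖ ≤ ‖toEll q y‖ :=
  Ell.norm_le_of_exponent_le h _ _ fun _ => rfl

/-- The norms decrease as the exponent grows, so the family is directed and a single norm suffices
for each neighbourhood. -/
theorem EllPlus.nhds_zero_hasBasis (hr : r ≠ ∞) :
    (𝓝 (0 : EllPlus r)).HasBasis (fun qε : ExpAbove r × ℝ => 0 < qε.2)
      fun qε => {y | ‖toEll qε.1 y‖ < qε.2} := by
  have := ExpAbove.nonempty hr
  have h1 : 𝓝 (0 : EllPlus r) = ⨅ q : ExpAbove r, Filter.comap (toEll q) (𝓝 0) := by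
    rw [nhds_iInf]
    refine iInf_congr fun q => ?_
    rw [nhds_induced, map_zero]
  have h2 : ∀ q : ExpAbove r, (Filter.comap (toEll q) (𝓝 0)).HasBasis (fun ε : ℝ => 0 < ε)
      fun ε => {y | ‖toEll q y‖ < ε} := by
    intro q
    have := (Metric.nhds_basis_ball (x := (0 : Ell q.1))).comap (toEll q)
    refine this.congr (fun _ => Iff.rfl) fun ε _ => ?_
    ext y
    simp
  have hmono : ∀ q s : ExpAbove r, q.1 ≤ s.1 →
      Filter.comap (toEll q) (𝓝 0) ≤ Filter.comap (toEll s) (𝓝 0) := by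
    intro q s h
    refine ((h2 q).le_basis_iff (h2 s)).2 fun ε hε => ⟨ε, hε, fun y hy => ?_⟩
    exact (norm_toEll_le_of_le h y).trans_lt hy
  have hdir : Directed (· ≥ ·) fun q : ExpAbove r => Filter.comap (toEll q) (𝓝 0) := by
    intro q s
    rcases le_total q.1 s.1 with h | h
    · exact ⟨q, le_rfl, hmono q s h⟩
    · exact ⟨s, hmono s q h, le_rfl⟩
  refine ⟨fun U => ?_⟩
  rw [h1, Filter.mem_iInf_of_directed hdir]
  simp only [(h2 _).mem_iff, Prod.exists]

theorem EllPlus.isVonNBounded_iff (hr : r ≠ ∞) {B : Set (EllPlus r)} :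
    Bornology.IsVonNBounded ℂ B ↔
      ∀ q : ExpAbove r, ∃ M : ℝ, ∀ y ∈ B, ‖toEll q y‖ ≤ M := by
  constructor
  · intro hB q
    have h1 := hB.image (⟨toEll q, continuous_toEll q⟩ : EllPlus r →L[ℂ] Ell q.1)
    obtain ⟨M, hM⟩ := (NormedSpace.isVonNBounded_iff' ℂ).1 h1
    exact ⟨M, fun y hy => hM _ ⟨y, hy, rfl⟩⟩
  · intro h
    rw [(nhds_zero_hasBasis hr).isVonNBounded_iff]
    rintro ⟨q, ε⟩ hε
    obtain ⟨M, hM⟩ := h q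
    simp only at hε
    rw [absorbs_iff_norm]
    refine ⟨(|M| + 1) / ε, fun c hc y hy => ?_⟩
    have hpos : 0 < (|M| + 1) / ε := by positivity
    have hc0 : 0 < ‖c‖ := hpos.trans_le hc
    refine ⟨c⁻¹ • y, ?_, smul_inv_smul₀ (norm_pos_iff.1 hc0) y⟩
    change ‖toEll q (c⁻¹ • y)‖ < ε
    rw [map_smul, norm_smul, norm_inv, inv_mul_lt_iff₀ hc0]
    rw [div_le_iff₀ hε] at hc
    have := hM y hy
    have := le_abs_self M
    linarith

theorem EllPlus.hasSum_single (hr : r ≠ ∞) (y : EllPlus r) :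
    HasSum (fun i => single i (toSeq y i)) y := by
  rw [HasSum, SummationFilter.unconditional_filter, ← tendsto_sub_nhds_zero_iff]
  rw [(nhds_zero_hasBasis hr).tendsto_right_iff]
  rintro ⟨q, ε⟩ hε
  have h1 := lp.hasSum_single q.2.2.ne (toEll q y)
  rw [HasSum, SummationFilter.unconditional_filter, Metric.tendsto_nhds] at h1
  filter_upwards [h1 ε hε] with s hs
  rw [dist_eq_norm] at hs
  change ‖toEll q _‖ < ε
  rw [map_sub, map_sum]
  simp only [toEll_single]
  exact hs

/-- Exponents decreasing to `r` determine the topology, and the image in the countable product of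
Banach spaces consists of the families whose components are the same sequence, a condition closed in
the coordinates. Hence `ℓ_{r+}` is completely metrizable, Baire and barrelled. -/
theorem EllPlus.isClosedEmbedding (u : ℕ → ExpAbove r) (hu : ∀ q : ExpAbove r, ∃ n, (u n).1 ≤ q.1) :
    Topology.IsClosedEmbedding fun (y : EllPlus r) (n : ℕ) => toEll (u n) y := by
  refine ⟨⟨⟨?_⟩, ?_⟩, ?_⟩
  · refine le_antisymm ?_ ?_
    · rw [← continuous_iff_le_induced]
      exact continuous_pi fun n => continuous_toEll (u n)
    · refine le_iInf fun q => ?_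
      obtain ⟨n, hn⟩ := hu q
      have h1 : Continuous fun z : ∀ n, Ell (u n).1 => Ell.inclusion hn (z n) :=
        (Ell.inclusion hn).continuous.comp (continuous_apply n)
      exact (induced_mono (continuous_iff_le_induced.1 h1)).trans (le_of_eq induced_compose)
  · intro x y h
    exact toSeq_injective (congrArg (fun z : Ell (u 0).1 => (z : ℕ → ℂ)) (congrFun h 0))
  · have h1 : Set.range (fun (y : EllPlus r) (n : ℕ) => toEll (u n) y)
        = ⋂ (n : ℕ) (i : ℕ), {z : ∀ n, Ell (u n).1 | z n i = z 0 i} := by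
      ext z
      simp only [Set.mem_range, Set.mem_iInter, Set.mem_ofPred_eq]
      constructor
      · rintro ⟨y, rfl⟩ n i
        rfl
      · intro hz
        have hmem : ∀ n, (z n : ℕ → ℂ) = z 0 := fun n => funext (hz n)
        refine ⟨(⟨z 0, fun q => ?_⟩ : ellPlus r), ?_⟩
        · obtain ⟨n, hn⟩ := hu q
          have := lp.memℓp (z n)
          rw [hmem n] at this
          exact this.of_exponent_ge hn
        · funext n
          exact lp.ext (hmem n).symm
    rw [h1]
    refine isClosed_iInter fun n => isClosed_iInter fun i => isClosed_eq ?_ ?_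
    · exact (lp.evalCLM ℂ (fun _ : ℕ => ℂ) (u n).1 i).continuous.comp (continuous_apply n)
    · exact (lp.evalCLM ℂ (fun _ : ℕ => ℂ) (u 0).1 i).continuous.comp (continuous_apply 0)

theorem EllPlus.barrelledSpace (hr : r ≠ ∞) : BarrelledSpace ℂ (EllPlus r) := by
  obtain ⟨u, hu⟩ := ExpAbove.exists_seq hr
  have := (isClosedEmbedding u hu).IsCompletelyMetrizableSpace
  have : BaireSpace (EllPlus r) := inferInstance
  infer_instance

end Plus

/-! ### The pairing of `ℓ_{p-}` and `ℓ_{p'+}` -/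

/-- The duality pairing `⟨x, y⟩ = ∑ x_i y_i` of `ℓ_q` and `ℓ_s`, for conjugate exponents. -/
def Ell.pairing {q s : ℝ≥0∞} [Fact (1 ≤ q)] [Fact (1 ≤ s)] (h : q.HolderConjugate s) :
    Ell q →L[ℂ] Ell s →L[ℂ] ℂ :=
  lp.dualPairing q s (fun _ => ContinuousLinearMap.mul ℂ ℂ) (K := 1) fun _ => by simp

section EllPairing

variable {q s : ℝ≥0∞} [Fact (1 ≤ q)] [Fact (1 ≤ s)] (h : q.HolderConjugate s)

theorem Ell.norm_pairing_le (x : Ell q) (y : Ell s) : ‖Ell.pairing h x y‖ ≤ ‖x‖ * ‖y‖ := by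
  have h1 : ‖Ell.pairing h‖ ≤ 1 := lp.norm_dualPairing _ _
  calc _ ≤ ‖Ell.pairing h‖ * ‖x‖ * ‖y‖ := (Ell.pairing h).le_opNorm₂ x y
    _ ≤ 1 * ‖x‖ * ‖y‖ := by gcongr
    _ = _ := by rw [one_mul]

end EllPairing

theorem Ell.summable_mul {q s : ℝ≥0∞} (h : q.HolderConjugate s) (hq : q ≠ ∞) (hs : s ≠ ∞) (x : Ell q) (y : Ell s) :
    Summable fun i => x i * y i := by
  refine Summable.of_norm ?_
  simp only [norm_mul]
  exact lp.summable_mul (ENNReal.HolderConjugate.toReal_of_ne_top hq hs) x y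

theorem ne_top_of_inv_add_inv {p p' : ℝ≥0∞} [Fact (1 < p)] (h : p⁻¹ + p'⁻¹ = 1) : p' ≠ ∞ := by
  rintro rfl
  rw [ENNReal.inv_top, add_zero, ENNReal.inv_eq_one] at h
  exact (Fact.out : 1 < p).ne' h

/-- Conjugation reverses strict inequalities. Arguing with inverses covers `p = ∞`, `p' = 1` as
well. -/
theorem ExpBelow.exists_conj {p p' : ℝ≥0∞} (h : p⁻¹ + p'⁻¹ = 1) (q : ExpBelow p) :
    ∃ s : ExpAbove p', q.1.HolderConjugate s.1 := by
  have hc : q.1.HolderConjugate (1 - q.1⁻¹)⁻¹ := ENNReal.HolderConjugate.inv_one_sub_inv' q.2.1.le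
  have hq1 : q.1⁻¹ < 1 := ENNReal.inv_lt_one.2 q.2.1
  have hsum : q.1⁻¹ + (1 - q.1⁻¹) = 1 := add_tsub_cancel_of_le hq1.le
  refine ⟨⟨(1 - q.1⁻¹)⁻¹, ?_, ?_⟩, hc⟩
  · by_contra hle
    rw [not_lt, ENNReal.inv_le_iff_inv_le] at hle
    have h1 : p⁻¹ < q.1⁻¹ := ENNReal.inv_lt_inv.2 q.2.2
    have h2 := ENNReal.add_lt_add_of_lt_of_le (ne_top_of_le_ne_top ENNReal.one_ne_top
      (h ▸ le_add_self : p'⁻¹ ≤ 1)) h1 hle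
    rw [h, hsum] at h2
    exact lt_irrefl _ h2
  · rw [ENNReal.inv_lt_top]
    exact tsub_pos_of_lt hq1

theorem ExpAbove.exists_conj {p p' : ℝ≥0∞} [Fact (1 ≤ p')] (h : p⁻¹ + p'⁻¹ = 1)
    (s : ExpAbove p') : ∃ q : ExpBelow p, q.1.HolderConjugate s.1 := by
  have hs1 : s.1⁻¹ < 1 := ENNReal.inv_lt_one.2 ((Fact.out : 1 ≤ p').trans_lt s.2.1)
  have hc : s.1.HolderConjugate (1 - s.1⁻¹)⁻¹ :=
    ENNReal.HolderConjugate.inv_one_sub_inv' ((Fact.out : 1 ≤ p').trans s.2.1.le)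
  have hsum : 1 - s.1⁻¹ + s.1⁻¹ = 1 := tsub_add_cancel_of_le hs1.le
  refine ⟨⟨(1 - s.1⁻¹)⁻¹, ?_, ?_⟩, hc.symm⟩
  · rw [ENNReal.one_lt_inv]
    exact ENNReal.sub_lt_self ENNReal.one_ne_top one_ne_zero (ENNReal.inv_ne_zero.2 s.2.2.ne)
  · by_contra hle
    rw [not_lt, ENNReal.le_inv_iff_le_inv] at hle
    have h1 : s.1⁻¹ < p'⁻¹ := ENNReal.inv_lt_inv.2 s.2.1
    have h2 := ENNReal.add_lt_add_of_le_of_lt (ne_top_of_le_ne_top ENNReal.one_ne_top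
      tsub_le_self) hle h1
    rw [h, hsum] at h2
    exact lt_irrefl _ h2

theorem ExpBelow.toReal_holderConjugate {p r : ℝ≥0∞} {q : ExpBelow p} {s : ExpAbove r}
    (h : q.1.HolderConjugate s.1) : q.1.toReal.HolderConjugate s.1.toReal :=
  ENNReal.HolderConjugate.toReal_of_ne_top q.ne_top s.2.2.ne

/-! ### Unit vectors and the coefficients of functionals -/

section Single

variable {p : ℝ≥0∞} [Fact (1 < p)]

/-- The sequence with a single nonzero entry, as an element of `ℓ_{p-}`. -/
def EllMinus.single (i : ℕ) (c : ℂ) : EllMinus p :=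
  (⟨Pi.single i c, by
    obtain ⟨q, hq⟩ := exists_between (Fact.out : 1 < p)
    refine ⟨⟨q, hq⟩, ?_⟩
    have h := lp.memℓp (lp.single q i c : Ell q)
    rwa [lp.coeFn_single] at h⟩ : ellMinus p)

theorem EllMinus.toSeq_single (i : ℕ) (c : ℂ) :
    toSeq (single i c : EllMinus p) = Pi.single i c := rfl

theorem EllMinus.incl_single (q : ExpBelow p) (i : ℕ) (c : ℂ) :
    incl q (lp.single q.1 i c) = single i c := by
  apply toSeq_injective
  rw [toSeq_single, ← lp.coeFn_single q.1]
  rfl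

theorem EllMinus.single_eq_smul (i : ℕ) (c : ℂ) :
    (single i c : EllMinus p) = c • single i 1 := by
  apply toSeq_injective
  rw [map_smul, toSeq_single, toSeq_single, ← Pi.single_smul, smul_eq_mul, mul_one]

/-- If a functional on `ℓ_{p-}` is bounded by `M` on the unit ball of a step `ℓ_q`, then its
coefficients have norm at most `M` in the dual space `ℓ_s`. -/
theorem EllMinus.exists_ell_of_bound {p' : ℝ≥0∞} {q : ExpBelow p} {s : ExpAbove p'}
    (hs : q.1.HolderConjugate s.1) (f : EllMinus p →ₗ[ℂ] ℂ) {M : ℝ} (hM : 0 ≤ M)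
    (hf : ∀ x : Ell q.1, ‖f (incl q x)‖ ≤ M * ‖x‖) :
    ∃ y : Ell s.1, (∀ i, y i = f (single i 1)) ∧ ‖y‖ ≤ M := by
  refine exists_ell_of_dual_bound (ExpBelow.toReal_holderConjugate hs) _ hM fun c F => ?_
  have h1 := hf (∑ i ∈ F, lp.single q.1 i (c i))
  rw [map_sum, map_sum] at h1
  simpa only [incl_single, single_eq_smul _ (c _), map_smul, smul_eq_mul] using h1

end Single

/-- Keeping the same constant `M` is essential for regularity, where one `M` serves a whole bounded
set of functionals. -/
theorem EllPlus.exists_ell_of_bound {p p' : ℝ≥0∞} [Fact (1 ≤ p')] {q : ExpBelow p} {s : ExpAbove p'}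
    (hs : q.1.HolderConjugate s.1) (g : EllPlus p' →ₗ[ℂ] ℂ) {M : ℝ} (hM : 0 ≤ M)
    (hg : ∀ y, ‖g y‖ ≤ M * ‖toEll s y‖) :
    ∃ x : Ell q.1, (∀ i, x i = g (single i 1)) ∧ ‖x‖ ≤ M := by
  refine exists_ell_of_dual_bound (ExpBelow.toReal_holderConjugate hs).symm _ hM fun c F => ?_
  have h1 := hg (∑ i ∈ F, single i (c i))
  have h2 : ∀ i, g (single i (c i)) = c i * g (single i 1) := fun i => by
    rw [single_eq_smul i (c i), map_smul, smul_eq_mul]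
  rw [map_sum, map_sum] at h1
  simpa only [toEll_single, h2] using h1

theorem summable_ellMinus_mul_ellPlus {p p' : ℝ≥0∞} [Fact (1 < p)]
    (h : p⁻¹ + p'⁻¹ = 1) (x : EllMinus p) (y : EllPlus p') :
    Summable fun i => EllMinus.toSeq x i * EllPlus.toSeq y i := by
  obtain ⟨q, x, rfl⟩ := x.exists_incl
  obtain ⟨s, hs⟩ := q.exists_conj h
  exact Ell.summable_mul hs q.ne_top s.2.2.ne x (EllPlus.toEll s y)

section Pairing

variable {p p' : ℝ≥0∞} [Fact (1 < p)] (h : p⁻¹ + p'⁻¹ = 1)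

/-- The duality pairing `⟨x, y⟩ = ∑ x_i y_i` of `ℓ_{p-}` and `ℓ_{p'+}`. -/
def minusPlusPairing : EllMinus p →ₗ[ℂ] EllPlus p' →ₗ[ℂ] ℂ :=
  LinearMap.mk₂ ℂ (fun x y => ∑' i, EllMinus.toSeq x i * EllPlus.toSeq y i)
    (fun x x' y => by
      rw [← (summable_ellMinus_mul_ellPlus h x y).tsum_add (summable_ellMinus_mul_ellPlus h x' y)]
      refine tsum_congr fun i => ?_
      rw [map_add, Pi.add_apply, add_mul])
    (fun c x y => by
      rw [smul_eq_mul, ← tsum_mul_left]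
      refine tsum_congr fun i => ?_
      rw [map_smul, Pi.smul_apply, smul_eq_mul, mul_assoc])
    (fun x y y' => by
      rw [← (summable_ellMinus_mul_ellPlus h x y).tsum_add (summable_ellMinus_mul_ellPlus h x y')]
      refine tsum_congr fun i => ?_
      rw [map_add, Pi.add_apply, mul_add])
    (fun c x y => by
      rw [smul_eq_mul, ← tsum_mul_left]
      refine tsum_congr fun i => ?_
      rw [map_smul, Pi.smul_apply, smul_eq_mul, mul_left_comm])

theorem minusPlusPairing_apply (x : EllMinus p) (y : EllPlus p') :
    minusPlusPairing h x y = ∑' i, EllMinus.toSeq x i * EllPlus.toSeq y i := rfl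

theorem minusPlusPairing_single_left (i : ℕ) (c : ℂ) (y : EllPlus p') :
    minusPlusPairing h (EllMinus.single i c) y = c * EllPlus.toSeq y i := by
  rw [minusPlusPairing_apply, EllMinus.toSeq_single, tsum_eq_single i, Pi.single_eq_same]
  intro j hj
  rw [Pi.single_eq_of_ne hj, zero_mul]

theorem minusPlusPairing_single_right (x : EllMinus p) (i : ℕ) (c : ℂ) :
    minusPlusPairing h x (EllPlus.single i c) = EllMinus.toSeq x i * c := by
  rw [minusPlusPairing_apply, EllPlus.toSeq_single, tsum_eq_single i, Pi.single_eq_same]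
  intro j hj
  rw [Pi.single_eq_of_ne hj, mul_zero]

variable [Fact (1 ≤ p')]

theorem minusPlusPairing_incl {q : ExpBelow p} {s : ExpAbove p'} (hs : q.1.HolderConjugate s.1)
    (x : Ell q.1) (y : EllPlus p') :
    minusPlusPairing h (EllMinus.incl q x) y = Ell.pairing hs x (EllPlus.toEll s y) := rfl

/-- The continuous functional on `ℓ_{p'+}` defined by an element of `ℓ_{p-}`. -/
def EllMinus.toDual : EllMinus p →ₗ[ℂ] StrongDual ℂ (EllPlus p') where
  toFun x := ⟨minusPlusPairing h x, by
    obtain ⟨q, x, rfl⟩ := x.exists_incl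
    obtain ⟨s, hs⟩ := q.exists_conj h
    exact (Ell.pairing hs x).continuous.comp (EllPlus.continuous_toEll s)⟩
  map_add' x x' := by
    ext y
    exact (minusPlusPairing h).map_add₂ x x' y
  map_smul' c x := by
    ext y
    exact (minusPlusPairing h).map_smul₂ c x y

theorem EllMinus.toDual_apply (x : EllMinus p) (y : EllPlus p') :
    toDual h x y = minusPlusPairing h x y := rfl

/-- The continuous functional on `ℓ_{p-}` defined by an element of `ℓ_{p'+}`. -/
def EllPlus.toDual : EllPlus p' →ₗ[ℂ] StrongDual ℂ (EllMinus p) where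
  toFun y := ⟨(minusPlusPairing h).flip y,
    continuous_of_indLimTopology_normedSpace EllMinus.incl _ fun q => by
      obtain ⟨s, hs⟩ := q.exists_conj h
      exact ((Ell.pairing hs).flip (EllPlus.toEll s y)).continuous⟩
  map_add' y y' := by
    ext x
    exact (minusPlusPairing h x).map_add y y'
  map_smul' c y := by
    ext x
    exact (minusPlusPairing h x).map_smul c y

theorem EllPlus.toDual_apply (y : EllPlus p') (x : EllMinus p) :
    toDual h y x = minusPlusPairing h x y := rfl

theorem EllMinus.toDual_injective : Function.Injective (toDual h : EllMinus p → _) := by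
  intro x x' hx
  refine toSeq_injective (funext fun i => ?_)
  have h1 := congrArg (fun f : StrongDual ℂ (EllPlus p') => f (EllPlus.single i 1)) hx
  simpa only [toDual_apply, minusPlusPairing_single_right, mul_one] using h1

theorem EllPlus.toDual_injective : Function.Injective (toDual h : EllPlus p' → _) := by
  intro y y' hy
  refine toSeq_injective (funext fun i => ?_)
  have h1 := congrArg (fun f : StrongDual ℂ (EllMinus p) => f (EllMinus.single i 1)) hy
  simpa only [toDual_apply, minusPlusPairing_single_left, one_mul] using h1

theorem EllPlus.exists_bound_of_continuous (hr : p' ≠ ∞) (P : Seminorm ℂ (EllPlus p'))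
    (hP : Continuous P) : ∃ (s : ExpAbove p') (M : ℝ), 0 ≤ M ∧ ∀ y, P y ≤ M * ‖toEll s y‖ := by
  have h1 : {y | P y < 1} ∈ 𝓝 (0 : EllPlus p') :=
    (isOpen_lt hP continuous_const).mem_nhds (by simp)
  obtain ⟨⟨s, ε⟩, hε, hsub⟩ := (nhds_zero_hasBasis hr).mem_iff.1 h1
  simp only at hε hsub
  refine ⟨s, ε⁻¹, (inv_pos.2 hε).le, fun y => ?_⟩
  rw [inv_mul_eq_div]
  rw [le_div_iff₀ hε]
  -- Scaling by `ε / t` with `t > ‖y‖_s` avoids dividing by a norm that may vanish and gives the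
  -- strict inequality needed.
  refine le_of_forall_gt_imp_ge_of_dense fun t ht => ?_
  have ht0 : 0 < t := (norm_nonneg _).trans_lt ht
  have hεt : 0 < ε / t := div_pos hε ht0
  have h2 : ‖toEll s (((ε / t : ℝ) : ℂ) • y)‖ < ε := by
    rw [map_smul, norm_smul, Complex.norm_real, Real.norm_of_nonneg hεt.le, div_mul_eq_mul_div,
      div_lt_iff₀ ht0]
    gcongr
  have h3 : P (((ε / t : ℝ) : ℂ) • y) < 1 := hsub h2
  rw [map_smul_eq_mul, Complex.norm_real, Real.norm_of_nonneg hεt.le, div_mul_eq_mul_div,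
    div_lt_one ht0] at h3
  linarith

/-- A continuous functional is bounded by one norm `‖·‖_s`, so its coefficients lie in the conjugate
`ℓ_q`; expansion in unit vectors recovers it. -/
theorem EllMinus.toDual_surjective : Function.Surjective (toDual h : EllMinus p → _) := by
  intro g
  have hr : p' ≠ ∞ := ne_top_of_inv_add_inv h
  obtain ⟨s, M, hM, hb⟩ := EllPlus.exists_bound_of_continuous hr
    ((normSeminorm ℂ ℂ).comp g.toLinearMap) g.continuous.norm
  obtain ⟨q, hq⟩ := s.exists_conj h
  obtain ⟨x, hx, -⟩ := EllPlus.exists_ell_of_bound hq g.toLinearMap hM hb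
  refine ⟨incl q x, ContinuousLinearMap.ext fun y => ?_⟩
  rw [toDual_apply, minusPlusPairing_apply, ← ((EllPlus.hasSum_single hr y).mapL g).tsum_eq]
  refine tsum_congr fun i => ?_
  rw [EllPlus.single_eq_smul, map_smul, smul_eq_mul, mul_comm]
  congr 1
  exact hx i

/-- Restriction to each step `ℓ_q` puts the coefficients in the conjugate `ℓ_s`, and every `s > p'`
arises so. -/
theorem EllPlus.toDual_surjective : Function.Surjective (toDual h : EllPlus p' → _) := by
  intro f
  have hmem : (fun i => f (EllMinus.single i 1)) ∈ ellPlus p' := by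
    intro s
    obtain ⟨q, hq⟩ := s.exists_conj h
    obtain ⟨y, hy, -⟩ := EllMinus.exists_ell_of_bound hq f.toLinearMap (norm_nonneg _)
      (f.comp ⟨EllMinus.incl q, EllMinus.continuous_incl q⟩).le_opNorm
    have h1 := lp.memℓp y
    rwa [show (y : ℕ → ℂ) = _ from funext hy] at h1
  refine ⟨(⟨_, hmem⟩ : ellPlus p'), ContinuousLinearMap.ext fun v => ?_⟩
  obtain ⟨q, x, rfl⟩ := v.exists_incl
  have h1 := (lp.hasSum_single q.ne_top x).mapL
    (f.comp ⟨EllMinus.incl q, EllMinus.continuous_incl q⟩)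
  refine (tsum_congr fun i => ?_).trans h1.tsum_eq
  change x i * f (EllMinus.single i 1) = f (EllMinus.incl q (lp.single q.1 i (x i)))
  rw [EllMinus.incl_single, EllMinus.single_eq_smul i (x i), map_smul, smul_eq_mul]

/-! ### Regularity of `ℓ_{p-}` -/

theorem exists_conj_exponent (p : ℝ≥0∞) [Fact (1 < p)] :
    ∃ p' : ℝ≥0∞, 1 ≤ p' ∧ p⁻¹ + p'⁻¹ = 1 := by
  have hp1 : p⁻¹ ≤ 1 := ENNReal.inv_le_one.2 (Fact.out : 1 < p).le
  refine ⟨(1 - p⁻¹)⁻¹, ENNReal.one_le_inv.2 tsub_le_self, ?_⟩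
  rw [inv_inv, add_tsub_cancel_of_le hp1]

/-- Uniform boundedness on the barrelled space `ℓ_{p'+}`: the supremum of the seminorms `|⟨x, ·⟩|`,
`x ∈ B`, is finite because each `y` is a continuous functional on `ℓ_{p-}`, hence continuous and
controlled by one `‖·‖_s`. -/
theorem EllMinus.exists_subset_image_closedBall {B : Set (EllMinus p)}
    (hB : Bornology.IsVonNBounded ℂ B) :
    ∃ (q : ExpBelow p) (M : ℝ), B ⊆ incl q '' Metric.closedBall 0 M := by
  obtain ⟨p', hp', h⟩ := exists_conj_exponent p
  have : Fact (1 ≤ p') := ⟨hp'⟩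
  have hr : p' ≠ ∞ := ne_top_of_inv_add_inv h
  have := EllPlus.barrelledSpace hr
  let P : B → Seminorm ℂ (EllPlus p') := fun x =>
    (normSeminorm ℂ ℂ).comp (minusPlusPairing h x.1)
  have hP : ∀ x, Continuous (P x) := fun x => (toDual h x.1).continuous.norm
  have hbdd : BddAbove (Set.range P) := by
    rw [Seminorm.bddAbove_range_iff]
    intro y
    obtain ⟨M, hM⟩ := (NormedSpace.isVonNBounded_iff' ℂ).1 (hB.image (EllPlus.toDual h y))
    refine ⟨M, ?_⟩
    rintro _ ⟨x, rfl⟩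
    exact hM _ ⟨x, x.2, rfl⟩
  have hcont : Continuous (⨆ x, P x : Seminorm ℂ (EllPlus p')) := by
    rw [Seminorm.coe_iSup_eq hbdd]
    exact Seminorm.continuous_iSup P hP hbdd
  obtain ⟨s, M, hM, hle⟩ := EllPlus.exists_bound_of_continuous hr _ hcont
  obtain ⟨q, hq⟩ := s.exists_conj h
  refine ⟨q, M, fun x hx => ?_⟩
  obtain ⟨z, hz, hzM⟩ := EllPlus.exists_ell_of_bound hq (minusPlusPairing h x) hM fun y =>
    (le_ciSup hbdd (⟨x, hx⟩ : B) y).trans (hle y)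
  refine ⟨z, mem_closedBall_zero_iff.2 hzM, toSeq_injective (funext fun i => ?_)⟩
  refine (hz i).trans ?_
  rw [minusPlusPairing_single_right, mul_one]

theorem EllMinus.isVonNBounded_image_closedBall (q : ExpBelow p) (M : ℝ) :
    Bornology.IsVonNBounded ℂ (incl q '' Metric.closedBall 0 M) :=
  (NormedSpace.isVonNBounded_closedBall ℂ (Ell q.1) M).image
    (⟨incl q, continuous_incl q⟩ : Ell q.1 →L[ℂ] EllMinus p)

end Pairing

/-! ### Strong duals -/

section StrongDuals

variable {p p' : ℝ≥0∞} [Fact (1 < p)] [Fact (1 ≤ p')] (h : p⁻¹ + p'⁻¹ = 1)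

/-- An absolutely convex set which meets every step `ℓ_q` in a neighbourhood of `0` is a
neighbourhood of `0` in `ℓ_{p-}`. -/
theorem EllMinus.mem_nhds_zero {W : Set (EllMinus p)} (hb : Balanced ℂ W) (hc : Convex ℝ W)
    (hW : ∀ q : ExpBelow p, ∃ ε > 0, ∀ x : Ell q.1, ‖x‖ < ε → incl q x ∈ W) :
    W ∈ 𝓝 (0 : EllMinus p) := by
  have key : ∀ q : ExpBelow p, incl q ⁻¹' W ∈ 𝓝 (0 : Ell q.1) := fun q => ?_
  · exact indLimTopology_mem_nhds_zero (E := fun q : ExpBelow p => Ell q.1) incl exists_incl hb hc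
      key
  obtain ⟨ε, hε, hsub⟩ := hW q
  refine Filter.mem_of_superset (Metric.ball_mem_nhds 0 hε) fun x hx => hsub x ?_
  rwa [mem_ball_zero_iff] at hx

/-- Polars of bounded sets are absolutely convex, so they need only be tested on each step, where
Hölder applies. -/
theorem EllMinus.continuous_toDual :
    Continuous (toDual h : EllMinus p → StrongDual ℂ (EllPlus p')) := by
  have hr : p' ≠ ∞ := ne_top_of_inv_add_inv h
  refine continuous_of_continuousAt_zero (toDual h) ?_
  rw [ContinuousAt, map_zero, (ContinuousLinearMap.hasBasis_nhds_zero_of_basis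
    (Metric.nhds_basis_closedBall (x := (0 : ℂ)))).tendsto_right_iff]
  rintro ⟨B, ε⟩ ⟨hB, hε⟩
  change {x | ∀ y ∈ B, toDual h x y ∈ Metric.closedBall (0 : ℂ) ε} ∈ 𝓝 (0 : EllMinus p)
  have hset : {x | ∀ y ∈ B, toDual h x y ∈ Metric.closedBall (0 : ℂ) ε}
      = ⋂ y ∈ B, ((normSeminorm ℂ ℂ).comp ((minusPlusPairing h).flip y)).closedBall 0 ε := by
    ext x
    simp only [Set.mem_iInter, Seminorm.mem_closedBall_zero, mem_closedBall_zero_iff,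
      Set.mem_ofPred_eq]
    rfl
  rw [hset]
  refine mem_nhds_zero (balanced_iInter₂ fun y _ => Seminorm.balanced_closedBall_zero _ _)
    (convex_iInter₂ fun y _ => Seminorm.convex_closedBall _ _ _) fun q => ?_
  obtain ⟨s, hs⟩ := q.exists_conj h
  obtain ⟨M, hM⟩ := (EllPlus.isVonNBounded_iff hr).1 hB s
  refine ⟨ε / (|M| + 1), by positivity, fun x hx => ?_⟩
  rw [lt_div_iff₀ (by positivity)] at hx
  simp only [Set.mem_iInter, Seminorm.mem_closedBall_zero]
  intro y hy
  change ‖minusPlusPairing h (incl q x) y‖ ≤ ε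
  rw [minusPlusPairing_incl h hs]
  calc _ ≤ ‖x‖ * ‖EllPlus.toEll s y‖ := Ell.norm_pairing_le hs _ _
    _ ≤ ‖x‖ * (|M| + 1) := by
      gcongr
      linarith [hM y hy, le_abs_self M]
    _ ≤ ε := hx.le

/-- Regularity enters here: a bounded set of `ℓ_{p-}` lies in one ball of one `ℓ_q`, so a single
norm `‖·‖_s` bounds its pairing with `y`. -/
theorem EllPlus.continuous_toDual :
    Continuous (toDual h : EllPlus p' → StrongDual ℂ (EllMinus p)) := by
  have hr : p' ≠ ∞ := ne_top_of_inv_add_inv h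
  refine continuous_of_continuousAt_zero (toDual h) ?_
  rw [ContinuousAt, map_zero, (ContinuousLinearMap.hasBasis_nhds_zero_of_basis
    (Metric.nhds_basis_closedBall (x := (0 : ℂ)))).tendsto_right_iff]
  rintro ⟨B, ε⟩ ⟨hB, hε⟩
  simp only at hB hε
  obtain ⟨q, M, hBM⟩ := EllMinus.exists_subset_image_closedBall hB
  obtain ⟨s, hs⟩ := q.exists_conj h
  have hpos : 0 < ε / (|M| + 1) := by positivity
  filter_upwards [(nhds_zero_hasBasis hr).mem_of_mem (i := (s, ε / (|M| + 1))) hpos] with y hy v hv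
  obtain ⟨x, hx, rfl⟩ := hBM hv
  rw [mem_closedBall_zero_iff] at hx
  change ‖toEll s y‖ < ε / (|M| + 1) at hy
  rw [lt_div_iff₀ (by positivity)] at hy
  rw [mem_closedBall_zero_iff, toDual_apply, minusPlusPairing_incl h hs]
  calc _ ≤ ‖x‖ * ‖toEll s y‖ := Ell.norm_pairing_le hs _ _
    _ ≤ (|M| + 1) * ‖toEll s y‖ := by
      gcongr
      linarith [le_abs_self M]
    _ ≤ ε := by linarith

theorem EllPlus.norm_toEll_le_of_bound_on_ball {q : ExpBelow p} {s : ExpAbove p'}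
    (hs : q.1.HolderConjugate s.1) (y : EllPlus p') {δ c : ℝ} (hδ : 0 < δ) (hc : 0 ≤ c)
    (hy : ∀ x : Ell q.1, ‖x‖ ≤ δ → ‖minusPlusPairing h (EllMinus.incl q x) y‖ ≤ c) :
    ‖toEll s y‖ ≤ c / δ := by
  have h1 : ∀ x : Ell q.1, ‖minusPlusPairing h (EllMinus.incl q x) y‖ ≤ c / δ * ‖x‖ :=
    LinearMap.bound_of_ball_bound' hδ c (((minusPlusPairing h).flip y).comp (EllMinus.incl q))
      fun x hx => hy x (mem_closedBall_zero_iff.1 hx)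
  obtain ⟨z, hz, hzM⟩ := EllMinus.exists_ell_of_bound hs ((minusPlusPairing h).flip y)
    (div_nonneg hc hδ.le) h1
  have h2 : toEll s y = z := by
    refine lp.ext (funext fun i => ?_)
    rw [hz i, LinearMap.flip_apply, minusPlusPairing_single_left, one_mul]
    rfl
  rwa [h2]

/-- `ℓ_{p'+}` is the strong dual of `ℓ_{p-}`. -/
def EllPlus.dualEquiv : EllPlus p' ≃L[ℂ] StrongDual ℂ (EllMinus p) where
  toLinearEquiv := LinearEquiv.ofBijective (toDual h) ⟨toDual_injective h, toDual_surjective h⟩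
  continuous_toFun := continuous_toDual h
  continuous_invFun := by
    have hr : p' ≠ ∞ := ne_top_of_inv_add_inv h
    set e := LinearEquiv.ofBijective (toDual h) ⟨toDual_injective h, toDual_surjective h⟩
    refine continuous_of_continuousAt_zero e.symm ?_
    rw [ContinuousAt, map_zero, (nhds_zero_hasBasis hr).tendsto_right_iff]
    rintro ⟨s, ε⟩ hε
    simp only at hε
    obtain ⟨q, hs⟩ := s.exists_conj h
    -- The unit ball of `ℓ_q` is bounded in `ℓ_{p-}`, and smallness on it bounds `‖y‖_s`; half of
    -- `ε` yields the strict inequality.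
    filter_upwards [ContinuousLinearMap.eventually_nhds_zero_mapsTo
      (EllMinus.isVonNBounded_image_closedBall q 1)
      (Metric.closedBall_mem_nhds (0 : ℂ) (half_pos hε))] with f hf
    obtain ⟨y, rfl⟩ := e.surjective f
    rw [e.symm_apply_apply]
    have h1 := norm_toEll_le_of_bound_on_ball h hs y one_pos (half_pos hε).le fun x hx => by
      have := hf ⟨x, mem_closedBall_zero_iff.2 hx, rfl⟩
      rwa [mem_closedBall_zero_iff] at this
    change ‖toEll s y‖ < ε
    linarith

theorem EllPlus.isVonNBounded_polar {W : Set (EllMinus p)} (hW : W ∈ 𝓝 0) :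
    Bornology.IsVonNBounded ℂ {y : EllPlus p' | ∀ x ∈ W, ‖minusPlusPairing h x y‖ ≤ 1} := by
  rw [isVonNBounded_iff (ne_top_of_inv_add_inv h)]
  intro s
  obtain ⟨q, hs⟩ := s.exists_conj h
  have h1 : EllMinus.incl q ⁻¹' W ∈ 𝓝 (0 : Ell q.1) :=
    (EllMinus.continuous_incl q).continuousAt.preimage_mem_nhds (by rwa [map_zero])
  obtain ⟨δ, hδ, hsub⟩ := Metric.nhds_basis_closedBall.mem_iff.1 h1
  exact ⟨1 / δ, fun y hy => norm_toEll_le_of_bound_on_ball h hs y hδ zero_le_one fun x hx =>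
    hy _ (hsub (mem_closedBall_zero_iff.2 hx))⟩

/-- The bipolar theorem for the pairing of `ℓ_{p-}` and `ℓ_{p'+}`. -/
theorem EllMinus.mem_of_forall_polar {W : Set (EllMinus p)} (h0 : 0 ∈ W) (hopen : IsOpen W)
    (hb : Balanced ℂ W) (hc : Convex ℝ W) {v : EllMinus p}
    (hv : ∀ y : EllPlus p', (∀ x ∈ W, ‖minusPlusPairing h x y‖ ≤ 1) →
      ‖minusPlusPairing h v y‖ < 1) : v ∈ W := by
  by_contra hvW
  obtain ⟨f, hfv, hfW⟩ := RCLike.separate_convex_open_set (𝕜 := ℂ) h0 hc hopen hvW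
  obtain ⟨y, rfl⟩ := EllPlus.toDual_surjective h f
  have h1 : ∀ x ∈ W, ‖minusPlusPairing h x y‖ ≤ 1 := by
    intro x hx
    set z := minusPlusPairing h x y with hz
    rcases eq_or_ne z 0 with hz0 | hz0
    · rw [hz0, norm_zero]
      exact zero_le_one
    · have hn : 0 < ‖z‖ := norm_pos_iff.2 hz0
      -- Rotating `x` by a unimodular scalar turns the bound on the real part into a bound on the
      -- modulus.
      have h2 : (starRingEnd ℂ z / (‖z‖ : ℂ)) • x ∈ W := by
        refine hb.smul_mem ?_ hx
        rw [norm_div, RCLike.norm_conj, Complex.norm_real, norm_norm, div_self hn.ne']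
      have h3 := hfW _ h2
      rw [map_smul, smul_eq_mul, EllPlus.toDual_apply, ← hz, div_mul_eq_mul_div,
        Complex.conj_mul', sq, mul_div_assoc, div_self (Complex.ofReal_ne_zero.2 hn.ne'), mul_one]
        at h3
      exact (show ‖z‖ < 1 from h3).le
  have h2 := hv y h1
  rw [← EllPlus.toDual_apply] at h2
  have h3 := RCLike.re_le_norm (EllPlus.toDual h y v)
  rw [hfv] at h3
  linarith

theorem Balanced.convexHull_real {E : Type*} [AddCommGroup E] [Module ℂ E] {s : Set E}
    (hs : Balanced ℂ s) : Balanced ℂ (convexHull ℝ s) := by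
  rw [balanced_iff_smul_mem]
  intro a ha x hx
  have hconv : Convex ℝ {x | a • x ∈ convexHull ℝ s} :=
    (convex_convexHull ℝ s).linear_preimage ((LinearMap.lsmul ℂ E a).restrictScalars ℝ)
  exact convexHull_min (fun y hy =>
    (show a • y ∈ convexHull ℝ s from subset_convexHull ℝ s (hs.smul_mem ha hy))) hconv hx

/-- Inside a convex neighbourhood, the real convex hull of the balanced core stays balanced and
inside; its interior is the required set. -/
theorem exists_isOpen_balanced_convex_subset {E : Type*} [AddCommGroup E] [Module ℂ E]
    [TopologicalSpace E] [IsTopologicalAddGroup E] [ContinuousSMul ℂ E] [LocallyConvexSpace ℝ E]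
    {U : Set E} (hU : U ∈ 𝓝 0) :
    ∃ W ⊆ U, 0 ∈ W ∧ IsOpen W ∧ Balanced ℂ W ∧ Convex ℝ W := by
  have : ContinuousSMul ℝ E := IsScalarTower.continuousSMul (M := ℝ) (α := E) ℂ
  obtain ⟨s, ⟨hs, hconv⟩, hsU⟩ := (LocallyConvexSpace.convex_basis_zero ℝ E).mem_iff.1 hU
  have h1 : convexHull ℝ (balancedCore ℂ s) ∈ 𝓝 (0 : E) :=
    Filter.mem_of_superset (balancedCore_mem_nhds_zero hs) (subset_convexHull ℝ _)
  have h2 : convexHull ℝ (balancedCore ℂ s) ⊆ s := convexHull_min (balancedCore_subset s) hconv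
  have h0 : (0 : E) ∈ interior (convexHull ℝ (balancedCore ℂ s)) := mem_interior_iff_mem_nhds.2 h1
  have h3 : Balanced ℂ (convexHull ℝ (balancedCore ℂ s)) := (balancedCore_balanced s).convexHull_real
  have h4 := (convex_convexHull ℝ (balancedCore ℂ s)).interior
  have h5 := h3.interior h0
  exact ⟨interior (convexHull ℝ (balancedCore ℂ s)), (interior_subset.trans h2).trans hsU, h0,
    isOpen_interior, h5, h4⟩

/-- `ℓ_{p-}` is the strong dual of `ℓ_{p'+}`. -/
def EllMinus.dualEquiv : EllMinus p ≃L[ℂ] StrongDual ℂ (EllPlus p') where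
  toLinearEquiv := LinearEquiv.ofBijective (toDual h) ⟨toDual_injective h, toDual_surjective h⟩
  continuous_toFun := continuous_toDual h
  continuous_invFun := by
    set e := LinearEquiv.ofBijective (toDual h) ⟨toDual_injective h, toDual_surjective h⟩
    refine continuous_of_continuousAt_zero e.symm ?_
    rw [ContinuousAt, map_zero]
    intro U hU
    obtain ⟨W, hWU, h0, hopen, hb, hc⟩ := exists_isOpen_balanced_convex_subset hU
    change ∀ᶠ g in 𝓝 0, e.symm g ∈ U
    -- The polar of `W` is bounded in `ℓ_{p'+}`, so being less than `1` on it is a strong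
    -- neighbourhood condition; the bipolar theorem then returns to `W`.
    filter_upwards [ContinuousLinearMap.eventually_nhds_zero_mapsTo
      (EllPlus.isVonNBounded_polar h (hopen.mem_nhds h0))
      (Metric.ball_mem_nhds (0 : ℂ) one_pos)] with g hg
    obtain ⟨v, rfl⟩ := e.surjective g
    rw [e.symm_apply_apply]
    refine hWU <| mem_of_forall_polar h h0 hopen hb hc fun y hy => ?_
    have := hg hy
    rwa [mem_ball_zero_iff] at this

theorem EllMinus.isReflexiveSpace : IsReflexiveSpace (EllMinus p) := by
  obtain ⟨p', hp', h⟩ := exists_conj_exponent p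
  have : Fact (1 ≤ p') := ⟨hp'⟩
  refine ⟨(dualEquiv h).trans
    ((EllPlus.dualEquiv h).arrowCongr (ContinuousLinearEquiv.refl ℂ ℂ)), fun x f => ?_⟩
  obtain ⟨y, rfl⟩ := (EllPlus.dualEquiv h).surjective f
  change dualEquiv h x ((EllPlus.dualEquiv h).symm (EllPlus.dualEquiv h y)) = _
  rw [ContinuousLinearEquiv.symm_apply_apply]
  rfl

/-! ### `ℓ_{p-}` as an (LB)-space -/

/-- The sequence is cofinal among the exponents below `p`, so each step factors through some
`ℓ_{r_k}` and the two limit topologies coincide. -/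
theorem EllMinus.isRegularLBLimit (r : ℕ → ExpBelow p) (hr : StrictMono r)
    (hlim : Filter.Tendsto (fun k => (r k).1) Filter.atTop (𝓝 p)) :
    IsRegularLBLimit (EllMinus p) (fun k => Ell (r k).1) (fun k => incl (r k)) := by
  have hcof : ∀ q : ExpBelow p, ∃ k, q.1 ≤ (r k).1 := fun q => by
    obtain ⟨k, hk⟩ := (hlim.eventually_const_lt q.2.2).exists
    exact ⟨k, hk.le⟩
  refine ⟨inferInstance, fun k => incl_injective _, fun k => ?_, fun v => ?_, ?_, fun B hB => ?_⟩
  · have hk : (r k).1 ≤ (r (k + 1)).1 := (hr k.lt_succ_self).le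
    exact ⟨Ell.inclusion hk, incl_inclusion hk⟩
  · obtain ⟨q, x, rfl⟩ := v.exists_incl
    obtain ⟨k, hk⟩ := hcof q
    exact ⟨k, Ell.inclusion hk x, incl_inclusion hk x⟩
  · refine le_antisymm ?_ ?_
    · exact indLimTopology_le _ (indLimTopology_isTopologicalAddGroup _)
        (indLimTopology_continuousSMul _) (indLimTopology_locallyConvexSpace _) fun q => by
        obtain ⟨k, hk⟩ := hcof q
        rw [← funext (incl_inclusion hk)]
        exact @Continuous.comp (Ell q.1) (Ell (r k).1) (EllMinus p) _ _
          (indLimTopology fun k => incl (r k)) (Ell.inclusion hk) (incl (r k))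
          (continuous_indLimTopology (fun k => incl (r k)) k) (Ell.inclusion hk).continuous
    · exact indLimTopology_le _ inferInstance inferInstance inferInstance fun k =>
        continuous_incl (r k)
  · obtain ⟨q, M, hBM⟩ := exists_subset_image_closedBall hB
    obtain ⟨k, hk⟩ := hcof q
    refine ⟨k, Ell.inclusion hk '' Metric.closedBall 0 M, ?_, ?_⟩
    · exact (Ell.inclusion hk).lipschitz.isBounded_image Metric.isBounded_closedBall
    · simpa only [Set.image_image, incl_inclusion] using hBM

theorem ExpBelow.exists_strictMono_tendsto (p : ℝ≥0∞) [Fact (1 < p)] :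
    ∃ r : ℕ → ExpBelow p, StrictMono r ∧
      Filter.Tendsto (fun k => (r k).1) Filter.atTop (𝓝 p) := by
  obtain ⟨u, hmono, hu, hlim⟩ := exists_seq_strictMono_tendsto' (Fact.out : 1 < p)
  exact ⟨fun n => ⟨u n, hu n⟩, hmono, hlim⟩

theorem EllMinus.isRegularLBSpace : IsRegularLBSpace (EllMinus p) := by
  obtain ⟨r, hr, hlim⟩ := ExpBelow.exists_strictMono_tendsto p
  exact ⟨_, _, _, _, _, isRegularLBLimit r hr hlim⟩

/-- Balls of radius `n` in the `n`-th step form a fundamental sequence by regularity. An absolutely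
convex set absorbing them contains a ball of every step. -/
theorem EllMinus.isDFSpace : IsDFSpace (EllMinus p) := by
  refine ⟨inferInstance, inferInstance, inferInstance, inferInstance, ?_, fun U hU habs => ?_⟩
  · obtain ⟨r, hr, hlim⟩ := ExpBelow.exists_strictMono_tendsto p
    refine ⟨fun n => incl (r n) '' Metric.closedBall 0 n,
      fun n => isVonNBounded_image_closedBall _ _, fun S hS => ?_⟩
    obtain ⟨q, M, hSM⟩ := exists_subset_image_closedBall hS
    obtain ⟨k, hk⟩ := (hlim.eventually_const_lt q.2.2).exists
    obtain ⟨m, hm⟩ := exists_nat_ge M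
    refine ⟨max k m, fun v hv => ?_⟩
    obtain ⟨x, hx, rfl⟩ := hSM hv
    have hq : q.1 ≤ (r (max k m)).1 := hk.le.trans (hr.monotone (le_max_left k m))
    refine ⟨Ell.inclusion hq x, ?_, incl_inclusion hq x⟩
    rw [mem_closedBall_zero_iff] at hx ⊢
    calc _ ≤ ‖x‖ := Ell.norm_le_of_exponent_le hq x _ fun _ => rfl
      _ ≤ (m : ℝ) := hx.trans hm
      _ ≤ _ := by exact_mod_cast le_max_right k m
  · refine mem_nhds_zero (balanced_iInter fun n => (hU n).2.1)
      (convex_iInter fun n => (hU n).2.2) fun q => ?_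
    obtain ⟨c, hc⟩ := absorbs_iff_norm.1 (habs _ (isVonNBounded_image_closedBall q 1))
    have hpos : 0 < max c 1 := lt_max_of_lt_right one_pos
    refine ⟨(max c 1)⁻¹, inv_pos.2 hpos, fun x hx => ?_⟩
    have hnorm : ‖((max c 1 : ℝ) : ℂ)‖ = max c 1 := by
      rw [Complex.norm_real, Real.norm_of_nonneg hpos.le]
    have hne : ((max c 1 : ℝ) : ℂ) ≠ 0 := Complex.ofReal_ne_zero.2 hpos.ne'
    have h1 : incl q (((max c 1 : ℝ) : ℂ) • x) ∈ incl q '' Metric.closedBall 0 1 := by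
      refine ⟨_, ?_, rfl⟩
      rw [mem_closedBall_zero_iff, norm_smul, hnorm]
      calc _ ≤ max c 1 * (max c 1)⁻¹ := by gcongr
        _ = 1 := mul_inv_cancel₀ hpos.ne'
    obtain ⟨y, hy, hyx⟩ := hc ((max c 1 : ℝ) : ℂ) (by rw [hnorm]; exact le_max_left _ _) h1
    have h2 : y = incl q x := by
      have h3 : ((max c 1 : ℝ) : ℂ) • y = ((max c 1 : ℝ) : ℂ) • incl q x := by
        rw [← map_smul]
        exact hyx
      exact smul_right_injective _ hne h3
    rwa [← h2]

/-- The unit vectors are bounded in any step, but `ℓ_{p-}` maps continuously to `ℓ_∞`, where their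
mutual distance is at least `1`; no subsequence converges there. -/
theorem EllMinus.not_isMontelLCS : ¬ IsMontelLCS (EllMinus p) := by
  rintro ⟨-, -, -, -, -, hM⟩
  obtain ⟨q⟩ : Nonempty (ExpBelow p) := by
    obtain ⟨q, hq⟩ := exists_between (Fact.out : 1 < p)
    exact ⟨⟨q, hq⟩⟩
  let S : Set (EllMinus p) := Set.range fun i => single i 1
  have hS : Bornology.IsVonNBounded ℂ S := by
    refine (isVonNBounded_image_closedBall q 1).subset ?_
    rintro _ ⟨i, rfl⟩
    refine ⟨lp.single q.1 i 1, ?_, incl_single q i 1⟩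
    rw [mem_closedBall_zero_iff, lp.norm_single (zero_lt_one.trans q.2.1), norm_one]
  have hcomp : IsCompact (closure S) := hM.heine_borel _ isClosed_closure hS.closure
  have himg := (hcomp.image (toEllInfty (p := p)).continuous).isSeqCompact
  obtain ⟨z, -, φ, hφ, hz⟩ := himg (x := fun i => toEllInfty (single i 1 : EllMinus p))
    fun i => ⟨_, subset_closure ⟨i, rfl⟩, rfl⟩
  obtain ⟨N, hN⟩ := Metric.cauchySeq_iff'.1 hz.cauchySeq 1 one_pos
  have h1 := hN (N + 1) N.le_succ
  rw [dist_eq_norm] at h1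
  have h2 := (lp.norm_apply_le_norm ENNReal.top_ne_zero _ (φ N)).trans_lt h1
  have hne : φ N ≠ φ (N + 1) := (hφ N.lt_succ_self).ne
  have h3 : (toEllInfty (single (φ (N + 1)) 1 : EllMinus p)
      - toEllInfty (single (φ N) 1 : EllMinus p) : Ell ∞) (φ N) = -1 := by
    change (Pi.single (φ (N + 1)) 1 : ℕ → ℂ) (φ N) - (Pi.single (φ N) 1 : ℕ → ℂ) (φ N) = -1
    rw [Pi.single_eq_same, Pi.single_eq_of_ne hne, zero_sub]
  rw [Function.comp_apply, Function.comp_apply, h3, norm_neg, norm_one] at h2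
  exact lt_irrefl _ h2

end StrongDuals

end

theorem proposition3p4 :
    -- (i)
    (∀ (p : ℝ≥0∞) [Fact (1 < p)],
      IsRegularLBSpace (EllMinus p) ∧
      (∀ r : ℕ → ExpBelow p, StrictMono r →
        Filter.Tendsto (fun k => (r k).1) Filter.atTop (𝓝 p) →
        IsRegularLBLimit (EllMinus p) (fun k => Ell (r k).1) (fun k => EllMinus.incl (r k))) ∧
      IsReflexiveSpace (EllMinus p) ∧
      ¬ IsMontelLCS (EllMinus p) ∧
      IsDFSpace (EllMinus p) ∧
      ∀ (p' : ℝ≥0∞) [Fact (1 ≤ p')], p⁻¹ + p'⁻¹ = 1 →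
        Nonempty (EllMinus p ≃L[ℂ] StrongDual ℂ (EllPlus p')) ∧
        Nonempty (StrongDual ℂ (EllMinus p) ≃L[ℂ] EllPlus p')) ∧
    -- (ii)
    (∀ (p q : ℝ≥0∞) [Fact (1 < p)] [Fact (1 < q)], p ≤ q →
      (∃ i : EllMinus p →L[ℂ] EllMinus q, ∀ x, (i x).toSeq = x.toSeq) ∧
      (p < q → ellMinus p < ellMinus q) ∧
      (∃ i : EllMinus p →L[ℂ] CesMinus q, ∀ x, (i x).toSeq = x.toSeq) ∧
      ellMinus p < cesMinus q) ∧
    -- (iii)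
    (∀ (p q : ℝ≥0∞) [Fact (1 < p)] [Fact (1 < q)], p ≤ q →
      (∃ T : EllMinus p →L[ℂ] EllMinus q, ∀ x, (T x).toSeq = cesaro x.toSeq) ∧
      (∃ T : CesMinus p →L[ℂ] EllMinus q, ∀ x, (T x).toSeq = cesaro x.toSeq)) ∧
    -- (iv)
    (∀ (p : ℝ≥0∞) [Fact (1 < p)] (x : ℕ → ℂ),
      cesaro (cesaro (absSeq x)) ∈ ellMinus p ↔ cesaro (absSeq x) ∈ ellMinus p) ∧
    -- (v) `ces(p-)` is the largest solid subspace that `C` maps into `ℓ_{p-}`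
    (∀ (p : ℝ≥0∞) [Fact (1 < p)],
      IsGreatest {X : Submodule ℂ (ℕ → ℂ) | IsSolid X ∧ ∀ x ∈ X, cesaro x ∈ ellMinus p}
        (cesMinus p)) := by

  refine ⟨fun p _ => ⟨EllMinus.isRegularLBSpace, EllMinus.isRegularLBLimit,
    EllMinus.isReflexiveSpace, EllMinus.not_isMontelLCS, EllMinus.isDFSpace, fun p' _ h =>
      ⟨⟨EllMinus.dualEquiv h⟩, ⟨(EllPlus.dualEquiv h).symm⟩⟩⟩, fun p q _ _ h =>
    ⟨⟨EllMinus.inclusion h, fun _ => rfl⟩, ellMinus_lt_ellMinus,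
      ⟨EllMinus.toCesMinus h, fun _ => rfl⟩, ellMinus_lt_cesMinus h⟩, fun p q _ _ h =>
    ⟨⟨(CesMinus.cesaroCLM h).comp (EllMinus.toCesMinus le_rfl), fun _ => rfl⟩,
      ⟨CesMinus.cesaroCLM h, fun _ => rfl⟩⟩, fun p _ => cesaro_cesaro_mem_ellMinus_iff,
    fun p _ => cesMinus_isGreatest⟩
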